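/- Let $\Sigma$ be a connected smooth 2-manifold and let $x:\Sigma\to\mathbb{R}^3$ be a smooth immersion with smooth unit normal field (Gauss map) $n:\Sigma\to S^2$, Gauss curvature $K$ and mean curvature $H$. Suppose that * $x$ is a channel surface, that is, $\Sigma$ carries a smooth one-dimensional foliation whose leaves are curvature lines and are mapped by $x$ into circles or straight lines; * $x$ is linear Weingarten, that is, there are constants $(a,b,c)\in\mathbb{R}^3\setminus\{0\}$ with $aK+2bH+c=0$ on $\Sigma$. Then at least one of the following holds. 1. $x$ is tubular, that is, one of the following holds: * $x$ is a tube about a space curve: there is a radius $\rho>0$ such that every point of $\Sigma$ has a neighbourhood $U$ with a smooth function $u:U\to\mathbb{R}$ without critical points and a smooth parametrized space curve $\gamma$ (which may have stationary points) such that $|x-\gamma(u)|=\rho$ and $x-\gamma(u)\perp\gamma'(u)$ on $U$; * $x$ is developable: $K\equiv 0$; * $x$ is totally umbilic. 2. $x$ is a parallel surface of a surface of revolution that is minimal or has constant Gauss curvature $\neq 0$: there is $t\in\mathbb{R}$ such that $y=x+t\,n$ is a surface of revolution (with one fixed axis; near each point of $\Sigma$ there are local coordinates in which $y$ is obtained by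 rotating a smooth profile curve about this axis), and either * $y$ is an immersion and, with Gauss map $n$, has mean curvature $H^t\equiv 0$; or * there is a constant $k\neq 0$ such that the set of points where $y$ is immersive is dense in $\Sigma$ and, with Gauss map $n$, the Gauss curvature of $y$ is $K^t=k$ at all these points (at other points $y$ may be singular). -/

import Mathlib

open scoped Manifold ContDiff RealInnerProductSpace

noncomputable section

namespace ChannelSurface

/-- The model plane of surfaces. -/
abbrev E2 : Type := EuclideanSpace ℝ (Fin 2)

/-- Euclidean three-space. -/
abbrev E3 : Type := EuclideanSpace ℝ (Fin 3)

section Surfaces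

variable {M : Type*} [TopologicalSpace M] [ChartedSpace E2 M]

/-- The differential of a map of the surface `M` into Euclidean space. -/
def diff (x : M → E3) (p : M) : TangentSpace 𝓘(ℝ, E2) p →L[ℝ] E3 :=
  mfderiv 𝓘(ℝ, E2) 𝓘(ℝ, E3) x p

/-- The differential of a real function on the surface `M`. -/
def fdiff (u : M → ℝ) (p : M) : TangentSpace 𝓘(ℝ, E2) p →L[ℝ] ℝ :=
  mfderiv 𝓘(ℝ, E2) 𝓘(ℝ, ℝ) u p

/-- `x` is regular (immersive) at `p`. -/
def IsRegularAt (x : M → E3) (p : M) : Prop :=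
  Function.Injective (diff x p)

/-- `n` is a smooth field of unit normals along the smooth map `x`, which may have singular points
(that is, points at which it is not regular). -/
structure IsNormalField (x n : M → E3) : Prop where
  smooth_map : ContMDiff 𝓘(ℝ, E2) 𝓘(ℝ, E3) ∞ x
  smooth_normal : ContMDiff 𝓘(ℝ, E2) 𝓘(ℝ, E3) ∞ n
  unit : ∀ p, ‖n p‖ = 1
  normal : ∀ p v, ⟪diff x p v, n p⟫ = 0

/-- A smoothly immersed surface `x : M → ℝ³` with Gauss map `n`. -/
structure IsSurface (x n : M → E3) : Prop extends IsNormalField x n where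
  regular : ∀ p, IsRegularAt x p

/-- The standard basis of the tangent plane at `p`. -/
def tangentBasis (p : M) (i : Fin 2) : TangentSpace 𝓘(ℝ, E2) p :=
  (EuclideanSpace.single i (1 : ℝ) : E2)

/-- The matrix of the first fundamental form. -/
def firstForm (x : M → E3) (p : M) : Matrix (Fin 2) (Fin 2) ℝ :=
  Matrix.of fun i j => ⟪diff x p (tangentBasis p i), diff x p (tangentBasis p j)⟫

/-- The matrix of the second fundamental form `-⟨dn, dx⟩`. -/
def secondForm (x n : M → E3) (p : M) : Matrix (Fin 2) (Fin 2) ℝ :=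
  Matrix.of fun i j => -⟪diff n p (tangentBasis p i), diff x p (tangentBasis p j)⟫

/-- The matrix of the shape operator; it is only used at regular points of `x`. -/
def shapeMatrix (x n : M → E3) (p : M) : Matrix (Fin 2) (Fin 2) ℝ :=
  (firstForm x p)⁻¹ * secondForm x n p

/-- The Gauss curvature. -/
def gaussCurvature (x n : M → E3) (p : M) : ℝ := (shapeMatrix x n p).det

/-- The mean curvature (the arithmetic mean of the principal curvatures). -/
def meanCurvature (x n : M → E3) (p : M) : ℝ := (shapeMatrix x n p).trace / 2

/-- A non-trivial linear Weingarten condition `a K + 2 b H + c = 0` holds. -/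
def IsLinearWeingarten (x n : M → E3) : Prop :=
  ∃ a b c : ℝ, (a ≠ 0 ∨ b ≠ 0 ∨ c ≠ 0) ∧
    ∀ p, a * gaussCurvature x n p + 2 * b * meanCurvature x n p + c = 0

/-- `A` is contained in a circle (of positive radius `r`, with centre `z`, in the plane
orthogonal to `τ`) or in a straight line. -/
def LiesOnCircleOrLine (A : Set E3) : Prop :=
  (∃ (z τ : E3) (r : ℝ), ‖τ‖ = 1 ∧ 0 < r ∧ ∀ y ∈ A, ‖y - z‖ = r ∧ ⟪y - z, τ⟫ = 0) ∨
  (∃ z τ : E3, ‖τ‖ = 1 ∧ ∀ y ∈ A, ∃ s : ℝ, y = z + s • τ)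

/-- A channel surface: there is a foliation of the surface by circular curvature lines.
The foliation is given by its tangent line field `D`; locally, its leaves are the level curves of a
smooth function `u` without critical points. The leaves are curvature lines by the condition
`dn = -k dx` along `D`, and `x` maps them to (arcs of) circles, where straight lines
are regarded as circles. -/
def IsChannel (x n : M → E3) : Prop :=
  ∃ D : (p : M) → Submodule ℝ (TangentSpace 𝓘(ℝ, E2) p),
    (∀ p, ∃ k : ℝ, ∀ v ∈ D p, diff n p v = -(k • diff x p v)) ∧
    ∀ p, ∃ (U : Set M) (u : M → ℝ), IsOpen U ∧ p ∈ U ∧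
      ContMDiffOn 𝓘(ℝ, E2) 𝓘(ℝ, ℝ) ∞ u U ∧
      (∀ q ∈ U, fdiff u q ≠ 0 ∧ ∀ v, v ∈ D q ↔ fdiff u q v = 0) ∧
      ∀ s : ℝ, LiesOnCircleOrLine (x '' {q | q ∈ U ∧ u q = s})

/-- All points are umbilics. -/
def IsTotallyUmbilic (x n : M → E3) : Prop :=
  ∀ p, ∃ k : ℝ, ∀ v, diff n p v = -(k • diff x p v)

/-- Developable surfaces are the surfaces of vanishing Gauss curvature. -/
def IsDevelopable (x n : M → E3) : Prop :=
  ∀ p, gaussCurvature x n p = 0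

/-- A tube: for some fixed radius `ρ > 0`, the surface is locally the envelope of spheres of
radius `ρ` whose centres run along a smooth space curve `γ`. That is, the point of the surface with
curve parameter `u` has distance `ρ` from `γ(u)` and lies in the normal plane of `γ` at `γ(u)`.
The parametrization `γ` of the curve may have stationary points. -/
def IsTube (x : M → E3) : Prop :=
  ∃ ρ : ℝ, 0 < ρ ∧ ∀ p, ∃ (U : Set M) (u : M → ℝ) (J : Set ℝ) (γ : ℝ → E3),
    IsOpen U ∧ p ∈ U ∧ ContMDiffOn 𝓘(ℝ, E2) 𝓘(ℝ, ℝ) ∞ u U ∧ (∀ q ∈ U, fdiff u q ≠ 0) ∧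
    IsOpen J ∧ Set.MapsTo u U J ∧ ContDiffOn ℝ ∞ γ J ∧
    ∀ q ∈ U, ‖x q - γ (u q)‖ = ρ ∧ ⟪x q - γ (u q), deriv γ (u q)⟫ = 0

/-- Tubular surfaces. -/
def IsTubular (x n : M → E3) : Prop :=
  IsTube x ∨ IsDevelopable x n ∨ IsTotallyUmbilic x n

/-- The parallel surface at (signed) distance `t`. -/
def parallel (x n : M → E3) (t : ℝ) (p : M) : E3 := x p + t • n p

/-- `y` is a surface of revolution with fixed axis through `o` in direction `F 2`: near
each point there are coordinates `(s, θ)` on the surface in which it is obtained by rotating a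
smooth profile curve `(r, h)`. Singular points of `y` are not excluded here. -/
def IsOfRevolution (y : M → E3) : Prop :=
  ∃ (o : E3) (F : OrthonormalBasis (Fin 3) ℝ E3),
    ∀ p, ∃ (U : Set M) (s θ : M → ℝ) (J : Set ℝ) (r h : ℝ → ℝ),
      IsOpen U ∧ p ∈ U ∧
      ContMDiffOn 𝓘(ℝ, E2) 𝓘(ℝ, ℝ) ∞ s U ∧ ContMDiffOn 𝓘(ℝ, E2) 𝓘(ℝ, ℝ) ∞ θ U ∧
      (∀ q ∈ U, ∀ v, fdiff s q v = 0 → fdiff θ q v = 0 → v = 0) ∧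
      IsOpen J ∧ Set.MapsTo s U J ∧ ContDiffOn ℝ ∞ r J ∧ ContDiffOn ℝ ∞ h J ∧
      ∀ q ∈ U, y q = o + (r (s q) * Real.cos (θ q)) • F 0
        + (r (s q) * Real.sin (θ q)) • F 1 + h (s q) • F 2

/-- A minimal surface (immersed, without singular points) with Gauss map `n`. -/
def IsMinimal (y n : M → E3) : Prop :=
  IsSurface y n ∧ ∀ p, meanCurvature y n p = 0

/-- A surface of constant Gauss curvature `k` with Gauss map `n`. Singular points, at which the
Gauss map is still smoothly defined, are allowed, but the regular points have to be dense. -/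
def HasConstantGaussCurvature (y n : M → E3) (k : ℝ) : Prop :=
  IsNormalField y n ∧ Dense {p | IsRegularAt y p} ∧
    ∀ p, IsRegularAt y p → gaussCurvature y n p = k

end Surfaces

end ChannelSurface

end

/-! Let `k` be the principal curvature along the leaves, `l` the other one, `∇` (`nabla`) the
derivative orthogonal to the leaves and `β` (`bend`) the geodesic curvature of the leaves up to a
factor. That the leaves are circles is used only through a Joachimsthal argument: it makes `k`
constant on each leaf. The rest follows from the Codazzi and Gauss equations, from uniqueness for
linear differential inequalities across the leaves, and from connectedness. The Weingarten relation,
multiplied by `a`, reads `(a k + b)(a l + b) = b² - a c`.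

If `b² - a c = 0`, then `a ≠ 0` and at every point `k` or `l` equals `κ = -b / a`. For `κ = 0` the
surface is developable. For `κ ≠ 0`, `k = κ` at one point implies `k = κ` everywhere
(`curv_eq_const_of_eq`); hence `k ≡ κ`, or `k ≠ κ` everywhere and `l ≡ κ`. In both cases `x + n / κ`
is stationary along one family of curvature lines, and so runs along the centre curve of a tube
(`isTube_of_local`).

If `b² - a c ≠ 0`, then `l` is determined by `k` and is constant on the leaves as well. By the
Codazzi equation `∇k = -(k - l) β`, the difference `k - l` solves a linear equation, so the surface
is totally umbilic or free of umbilics. Without umbilics `β` is constant on the leaves too, and the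
Gauss equation closes a linear system for `(K, β)`. Consequently `K` vanishes identically as soon as
it vanishes on a nonempty open set. Otherwise `k` and `β` have no common zero, and each leaf has an
axis, with direction `k ∇X + β N`. The structure equations show that this axis is the same for all
leaves of a patch (`axis_eq`), hence for all leaves of the surface (`exists_axis`), and all parallel
surfaces are surfaces of revolution.

It remains to choose the distance `t`. The parallel surface has principal curvatures `k / (1 - t k)`
and `l / (1 - t l)`. For `c = 0` the value `t = -a / (2 b)` makes their sum vanish. For `c ≠ 0` and
`t = -b / c` one has `(1 - t k)(1 - t l) = (b² - a c) K / c²`, so the Gauss curvature is `c² / (b² -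
a c)` wherever `K ≠ 0`, which is a dense set. -/

namespace ChannelSurface

/-! ### Orthogonal frames in three-space and curvatures from a principal basis -/

section LinearAlgebra

/-- Otherwise there would be four linearly independent vectors in dimension three. Vector identities
are proved from this by comparing components in an orthogonal frame that need not be normalised. -/
theorem eq_zero_of_inner_eq_zero {a b c v : E3} (ha : a ≠ 0) (hb : b ≠ 0) (hc : c ≠ 0)
    (hab : ⟪a, b⟫ = 0) (hac : ⟪a, c⟫ = 0) (hbc : ⟪b, c⟫ = 0)
    (hva : ⟪v, a⟫ = 0) (hvb : ⟪v, b⟫ = 0) (hvc : ⟪v, c⟫ = 0) : v = 0 := by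
  by_contra hv
  have hba : ⟪b, a⟫ = 0 := by rw [real_inner_comm]; exact hab
  have hca : ⟪c, a⟫ = 0 := by rw [real_inner_comm]; exact hac
  have hcb : ⟪c, b⟫ = 0 := by rw [real_inner_comm]; exact hbc
  have hav : ⟪a, v⟫ = 0 := by rw [real_inner_comm]; exact hva
  have hbv : ⟪b, v⟫ = 0 := by rw [real_inner_comm]; exact hvb
  have hcv : ⟪c, v⟫ = 0 := by rw [real_inner_comm]; exact hvc
  have h : LinearIndependent ℝ ![a, b, c, v] := by
    apply linearIndependent_of_ne_zero_of_inner_eq_zero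
    · intro i; fin_cases i <;> simpa
    · intro i j hij
      fin_cases i <;> fin_cases j <;> first | exact absurd rfl hij | simpa
  have := h.fintype_card_le_finrank
  simp at this

theorem eq_of_inner_eq {a b c v w : E3} (ha : a ≠ 0) (hb : b ≠ 0) (hc : c ≠ 0)
    (hab : ⟪a, b⟫ = 0) (hac : ⟪a, c⟫ = 0) (hbc : ⟪b, c⟫ = 0)
    (hva : ⟪v, a⟫ = ⟪w, a⟫) (hvb : ⟪v, b⟫ = ⟪w, b⟫) (hvc : ⟪v, c⟫ = ⟪w, c⟫) : v = w := by
  rw [← sub_eq_zero]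
  apply eq_zero_of_inner_eq_zero ha hb hc hab hac hbc <;> rw [inner_sub_left] <;> linarith

-- In the basis given by the columns of `V` both forms are diagonal, so `I⁻¹ * A` is conjugate to
-- `diagonal ![k, l]` by `V`.
open Matrix in
theorem det_trace_of_simultaneous_diagonalization {I A V : Matrix (Fin 2) (Fin 2) ℝ} {p q k l : ℝ}
    (hp : p ≠ 0) (hq : q ≠ 0) (hI : Vᵀ * I * V = diagonal ![p, q])
    (hA : Vᵀ * A * V = diagonal ![p * k, q * l]) :
    (I⁻¹ * A).det = k * l ∧ (I⁻¹ * A).trace = k + l := by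
  have hdet : V.det * I.det * V.det = p * q := by
    have := congrArg Matrix.det hI
    simpa [det_mul, det_diagonal, Fin.prod_univ_two] using this
  have hV : IsUnit V.det := by
    rw [isUnit_iff_ne_zero]; rintro h; rw [h] at hdet; simp [hp, hq] at hdet
  have hIu : IsUnit I.det := by
    rw [isUnit_iff_ne_zero]; rintro h; rw [h] at hdet; simp [hp, hq] at hdet
  have hVt : IsUnit Vᵀ.det := by rwa [det_transpose]
  have hd : (diagonal ![p * k, q * l] : Matrix (Fin 2) (Fin 2) ℝ)
      = diagonal ![p, q] * diagonal ![k, l] := by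
    rw [diagonal_mul_diagonal]; congr 1; ext i; fin_cases i <;> simp
  have h1 : A * V = I * V * diagonal ![k, l] := by
    have : Vᵀ * (A * V) = Vᵀ * (I * V * diagonal ![k, l]) := by
      rw [← Matrix.mul_assoc, hA, hd, ← hI]; simp only [Matrix.mul_assoc]
    have h2 := congrArg (fun m => Vᵀ⁻¹ * m) this
    simpa [← Matrix.mul_assoc, nonsing_inv_mul _ hVt] using h2
  have h2 : I⁻¹ * A = V * diagonal ![k, l] * V⁻¹ := by
    have : I⁻¹ * (A * V) * V⁻¹ = I⁻¹ * (I * V * diagonal ![k, l]) * V⁻¹ := by rw [h1]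
    rw [← Matrix.mul_assoc, Matrix.mul_assoc (I⁻¹ * A), mul_nonsing_inv _ hV,
      Matrix.mul_one] at this
    rw [this, ← Matrix.mul_assoc, ← Matrix.mul_assoc, nonsing_inv_mul _ hIu, Matrix.one_mul]
  rw [h2]
  constructor
  · rw [det_mul, det_mul, mul_comm, ← mul_assoc, ← det_mul, nonsing_inv_mul _ hV]
    simp [Fin.prod_univ_two]
  · rw [trace_mul_comm, ← Matrix.mul_assoc, nonsing_inv_mul _ hV]
    simp [trace, Fin.sum_univ_two]

/-- If the shape operator is diagonal in the basis `v, w`, the curvatures are the symmetric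
functions of its eigenvalues. -/
theorem det_trace_gram (P L : E2 →L[ℝ] E3) (hP : Function.Injective P) {v w : E2}
    (hv : v ≠ 0) (hw : w ≠ 0) (hvw : ⟪P v, P w⟫ = 0) {k l : ℝ}
    (hk : L v = -(k • P v)) (hl : L w = -(l • P w)) (b : Fin 2 → E2)
    (hb : ∀ i, b i = EuclideanSpace.single i (1 : ℝ)) :
    ((Matrix.of fun i j => ⟪P (b i), P (b j)⟫ : Matrix (Fin 2) (Fin 2) ℝ)⁻¹ *
      (Matrix.of fun i j => -⟪L (b i), P (b j)⟫)).det = k * l ∧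
    ((Matrix.of fun i j => ⟪P (b i), P (b j)⟫ : Matrix (Fin 2) (Fin 2) ℝ)⁻¹ *
      (Matrix.of fun i j => -⟪L (b i), P (b j)⟫)).trace = k + l := by
  have hP0 : ∀ u, u ≠ 0 → P u ≠ 0 := fun u hu h => hu (hP (by rw [h, map_zero]))
  have hpp : 0 < ⟪P v, P v⟫ := real_inner_self_pos.2 (hP0 v hv)
  have hqq : 0 < ⟪P w, P w⟫ := real_inner_self_pos.2 (hP0 w hw)
  have hwv : ⟪P w, P v⟫ = 0 := by rw [real_inner_comm]; exact hvw
  have key : ∀ (Q R : E2 →L[ℝ] E3) (u u' : E2), ⟪Q u, R u'⟫ =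
      u 0 * (u' 0 * ⟪Q (b 0), R (b 0)⟫ + u' 1 * ⟪Q (b 0), R (b 1)⟫) +
      u 1 * (u' 0 * ⟪Q (b 1), R (b 0)⟫ + u' 1 * ⟪Q (b 1), R (b 1)⟫) := by
    have : ∀ u : E2, u = u 0 • b 0 + u 1 • b 1 := by
      intro u; ext i; fin_cases i <;> simp [hb]
    intro Q R u u'
    conv_lhs => rw [this u, this u']
    simp only [map_add, map_smul, inner_add_left, inner_add_right, real_inner_smul_left,
      real_inner_smul_right]
    ring
  apply det_trace_of_simultaneous_diagonalization (V := !![v 0, w 0; v 1, w 1]) hpp.ne' hqq.ne'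
  · have e1 := key P P v v
    have e2 := key P P v w
    have e3 := key P P w v
    have e4 := key P P w w
    rw [hvw] at e2
    rw [hwv] at e3
    ext i j
    fin_cases i <;> fin_cases j <;>
      simp [Matrix.mul_apply, Fin.sum_univ_two, Matrix.diagonal, -inner_self_eq_norm_sq_to_K] <;>
      first | linear_combination -e1 | linear_combination -e2 | linear_combination -e3 |
        linear_combination -e4
  · have e1 := key L P v v
    have e2 := key L P v w
    have e3 := key L P w v
    have e4 := key L P w w
    rw [hk, inner_neg_left, real_inner_smul_left] at e1 e2
    rw [hl, inner_neg_left, real_inner_smul_left] at e3 e4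
    rw [hvw] at e2
    rw [hwv] at e3
    ext i j
    fin_cases i <;> fin_cases j <;>
      simp [Matrix.mul_apply, Fin.sum_univ_two, Matrix.diagonal, -inner_self_eq_norm_sq_to_K] <;>
      first | linear_combination e1 | linear_combination e2 | linear_combination e3 |
        linear_combination e4

end LinearAlgebra

/-! ### Uniqueness for linear differential inequalities -/

section LinearODE

variable {V : Type*} [NormedAddCommGroup V] [NormedSpace ℝ V]

/-- Grönwall's inequality; the continuous coefficient `c` is replaced by an upper bound on the
compact interval. -/
theorem eq_zero_of_norm_deriv_le_right {f f' : ℝ → V} {c : ℝ → ℝ} {s₀ s₁ : ℝ}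
    (hs : s₀ ≤ s₁) (hf : ∀ s ∈ Set.Icc s₀ s₁, HasDerivAt f (f' s) s)
    (hc : ContinuousOn c (Set.Icc s₀ s₁)) (hle : ∀ s ∈ Set.Icc s₀ s₁, ‖f' s‖ ≤ c s * ‖f s‖)
    (h0 : f s₀ = 0) : f s₁ = 0 := by
  obtain ⟨K, hK⟩ := isCompact_Icc.bddAbove_image hc
  refine eq_zero_of_abs_deriv_le_mul_abs_self_of_eq_zero_right (f := f) (f' := f') (K := K)
    (a := s₀) (b := s₁)
    (fun s hs => (hf s hs).continuousAt.continuousWithinAt)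
    (fun s hs => (hf s (Set.Ico_subset_Icc_self hs)).hasDerivWithinAt) h0
    (fun s hs => ?_) s₁ ⟨hs, le_rfl⟩
  have hs' := Set.Ico_subset_Icc_self hs
  exact (hle s hs').trans (mul_le_mul_of_nonneg_right (hK ⟨s, hs', rfl⟩) (norm_nonneg _))

/-- Uniqueness for homogeneous linear differential inequalities on an interval. -/
theorem eq_zero_of_norm_deriv_le {f f' : ℝ → V} {c : ℝ → ℝ} {I : Set ℝ} (hI : I.OrdConnected)
    (hf : ∀ s ∈ I, HasDerivAt f (f' s) s) (hc : ContinuousOn c I)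
    (hle : ∀ s ∈ I, ‖f' s‖ ≤ c s * ‖f s‖) {s₀ : ℝ} (hs₀ : s₀ ∈ I) (h0 : f s₀ = 0) :
    ∀ s ∈ I, f s = 0 := by
  intro s₁ hs₁
  rcases le_total s₀ s₁ with h | h
  · have hsub := hI.out hs₀ hs₁
    exact eq_zero_of_norm_deriv_le_right h (fun s hs => hf s (hsub hs)) (hc.mono hsub)
      (fun s hs => hle s (hsub hs)) h0
  · have hsub := hI.out hs₁ hs₀
    -- To the left of `s₀` the reflection `s ↦ -s` reduces the claim to the other case.
    have hm : ∀ s ∈ Set.Icc (-s₀) (-s₁), -s ∈ Set.Icc s₁ s₀ := fun s hs =>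
      ⟨by linarith [hs.2], by linarith [hs.1]⟩
    have := eq_zero_of_norm_deriv_le_right (f := fun s => f (-s)) (f' := fun s => -f' (-s))
      (c := fun s => c (-s)) (s₀ := -s₀) (s₁ := -s₁) (by linarith)
      (fun s hs => by
        simpa [Function.comp_def] using (hf (-s) (hsub (hm s hs))).scomp s (hasDerivAt_neg s))
      ((hc.mono hsub).comp continuous_neg.continuousOn hm)
      (fun s hs => by simpa using hle (-s) (hsub (hm s hs))) (by simpa using h0)
    simpa using this

end LinearODE

/-! ### Calculus of directional derivatives in the parameter plane -/

section PartialDerivatives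

variable {V : Type*} [NormedAddCommGroup V] [NormedSpace ℝ V]

/-- The directional derivative of `f` at `z` in the direction `w`. -/
noncomputable def pd (w : ℝ × ℝ) (f : ℝ × ℝ → V) (z : ℝ × ℝ) : V := fderiv ℝ f z w

variable {B : Set (ℝ × ℝ)} {z w w' : ℝ × ℝ}

theorem contDiffOn_pd {f : ℝ × ℝ → V} (hB : IsOpen B) (hf : ContDiffOn ℝ ∞ f B) :
    ContDiffOn ℝ ∞ (pd w f) B :=
  (hf.fderiv_of_isOpen hB (m := ∞) (by simp)).clm_apply contDiffOn_const

theorem differentiableAt_of_contDiffOn {f : ℝ × ℝ → V} (hB : IsOpen B)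
    (hf : ContDiffOn ℝ ∞ f B) (hz : z ∈ B) : DifferentiableAt ℝ f z :=
  (hf.contDiffAt (hB.mem_nhds hz)).differentiableAt (by simp)

theorem pd_comm {f : ℝ × ℝ → V} (hB : IsOpen B) (hf : ContDiffOn ℝ ∞ f B) (hz : z ∈ B) :
    pd w (pd w' f) z = pd w' (pd w f) z := by
  have hs : IsSymmSndFDerivAt ℝ f z :=
    (hf.contDiffAt (hB.mem_nhds hz)).isSymmSndFDerivAt (by simp; exact WithTop.coe_le_coe.2 le_top)
  have hd : DifferentiableAt ℝ (fderiv ℝ f) z :=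
    differentiableAt_of_contDiffOn hB (hf.fderiv_of_isOpen hB (m := ∞) (by simp)) hz
  have h : ∀ u u', pd u (pd u' f) z = fderiv ℝ (fderiv ℝ f) z u u' := by
    intro u u'
    have : HasFDerivAt (fun y => fderiv ℝ f y u') _ z :=
      hd.hasFDerivAt.clm_apply (hasFDerivAt_const u' z)
    unfold pd
    rw [this.fderiv]
    simp
  rw [h, h, hs.eq]

theorem pd_congr {f g : ℝ × ℝ → V} (hB : IsOpen B) (h : ∀ y ∈ B, f y = g y) (hz : z ∈ B) :
    pd w f z = pd w g z := by
  have : f =ᶠ[nhds z] g := Filter.eventually_of_mem (hB.mem_nhds hz) h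
  unfold pd
  rw [this.fderiv_eq]

theorem pd_eq_zero_of_eqOn_const {f : ℝ × ℝ → V} {c : V} (hB : IsOpen B) (h : ∀ y ∈ B, f y = c)
    (hz : z ∈ B) : pd w f z = 0 := by
  rw [pd_congr hB h hz (g := fun _ => c)]
  simp [pd]

theorem pd_add {f g : ℝ × ℝ → V} (hf : DifferentiableAt ℝ f z) (hg : DifferentiableAt ℝ g z) :
    pd w (fun y => f y + g y) z = pd w f z + pd w g z := by
  unfold pd
  rw [fderiv_fun_add hf hg]; rfl

theorem pd_sub {f g : ℝ × ℝ → V} (hf : DifferentiableAt ℝ f z) (hg : DifferentiableAt ℝ g z) :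
    pd w (fun y => f y - g y) z = pd w f z - pd w g z := by
  unfold pd
  rw [fderiv_fun_sub hf hg]; rfl

theorem pd_sub_const {f : ℝ × ℝ → V} {c : V} : pd w (fun y => f y - c) z = pd w f z := by
  unfold pd; rw [fderiv_sub_const]

theorem pd_neg {f : ℝ × ℝ → V} : pd w (fun y => -f y) z = -pd w f z := by
  unfold pd
  rw [fderiv_fun_neg]; rfl

theorem pd_smul {a : ℝ × ℝ → ℝ} {f : ℝ × ℝ → V} (ha : DifferentiableAt ℝ a z)
    (hf : DifferentiableAt ℝ f z) :
    pd w (fun y => a y • f y) z = a z • pd w f z + pd w a z • f z := by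
  unfold pd
  rw [fderiv_fun_smul ha hf]; rfl

theorem pd_mul {a f : ℝ × ℝ → ℝ} (ha : DifferentiableAt ℝ a z) (hf : DifferentiableAt ℝ f z) :
    pd w (fun y => a y * f y) z = a z * pd w f z + pd w a z * f z :=
  pd_smul ha hf

theorem pd_inner {f g : ℝ × ℝ → E3} (hf : DifferentiableAt ℝ f z) (hg : DifferentiableAt ℝ g z) :
    pd w (fun y => ⟪f y, g y⟫) z = ⟪pd w f z, g z⟫ + ⟪f z, pd w g z⟫ := by
  unfold pd
  rw [fderiv_inner_apply ℝ hf hg, add_comm]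

theorem pd_add_dir {f : ℝ × ℝ → V} : pd (w + w') f z = pd w f z + pd w' f z := by simp [pd]

theorem pd_smul_dir {f : ℝ × ℝ → V} {c : ℝ} : pd (c • w) f z = c • pd w f z := by simp [pd]

theorem pd_eq {f : ℝ × ℝ → V} : pd w f z = w.1 • pd (1, 0) f z + w.2 • pd (0, 1) f z := by
  rw [← pd_smul_dir, ← pd_smul_dir, ← pd_add_dir]
  simp

end PartialDerivatives

/-! ### Structure equations of a patch whose `t`-curves are curvature lines -/

section Patch

/-- The first coordinate direction of the parameter plane. -/
abbrev es : ℝ × ℝ := (1, 0)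

/-- The second coordinate direction of the parameter plane. -/
abbrev et : ℝ × ℝ := (0, 1)

/-- The squared speed of the `t`-curves. -/
noncomputable def leafSq (X : ℝ × ℝ → E3) (z : ℝ × ℝ) : ℝ := ⟪pd et X z, pd et X z⟫

/-- The vector field `(1, -shift)` is orthogonal to the `t`-curves. -/
noncomputable def shift (X : ℝ × ℝ → E3) (z : ℝ × ℝ) : ℝ := ⟪pd es X z, pd et X z⟫ / leafSq X z

/-- The derivative along the field `(1, -shift)` orthogonal to the `t`-curves. -/
noncomputable def nabla {V : Type*} [NormedAddCommGroup V] [NormedSpace ℝ V]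
    (X : ℝ × ℝ → E3) (f : ℝ × ℝ → V) (z : ℝ × ℝ) : V := pd (1, -shift X z) f z

/-- The tangent vector field orthogonal to the `t`-curves. -/
noncomputable def cross (X : ℝ × ℝ → E3) (z : ℝ × ℝ) : E3 := nabla X X z

/-- The squared length of `cross`. -/
noncomputable def crossSq (X : ℝ × ℝ → E3) (z : ℝ × ℝ) : ℝ := ⟪cross X z, cross X z⟫

/-- The principal curvature in the direction of `cross`. -/
noncomputable def crossCurv (X N : ℝ × ℝ → E3) (z : ℝ × ℝ) : ℝ :=
  -(⟪nabla X N z, cross X z⟫ / crossSq X z)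

/-- The geodesic curvature of the `t`-curves, up to a factor. -/
noncomputable def bend (X : ℝ × ℝ → E3) (z : ℝ × ℝ) : ℝ :=
  ⟪pd et (cross X) z, pd et X z⟫ / leafSq X z

/-- A parametrized surface `X` with Gauss map `N` whose `t`-curves are curvature lines with
principal curvature `k`. -/
structure IsPatch (I J : Set ℝ) (X N : ℝ × ℝ → E3) (k : ℝ × ℝ → ℝ) : Prop where
  isOpen_fst : IsOpen I
  isOpen_snd : IsOpen J
  ordConnected_fst : I.OrdConnected
  ordConnected_snd : J.OrdConnected
  smooth_map : ContDiffOn ℝ ∞ X (I ×ˢ J)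
  smooth_normal : ContDiffOn ℝ ∞ N (I ×ˢ J)
  unit : ∀ z ∈ I ×ˢ J, ⟪N z, N z⟫ = 1
  normal : ∀ z ∈ I ×ˢ J, ∀ w, ⟪N z, pd w X z⟫ = 0
  regular : ∀ z ∈ I ×ˢ J, ∀ w, pd w X z = 0 → w = 0
  curvature_line : ∀ z ∈ I ×ˢ J, pd et N z = -(k z • pd et X z)

variable {V : Type*} [NormedAddCommGroup V] [NormedSpace ℝ V]

theorem nabla_eq {X : ℝ × ℝ → E3} {f : ℝ × ℝ → V} {z : ℝ × ℝ} :
    nabla X f z = pd es f z - shift X z • pd et f z := by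
  rw [nabla, pd_eq]; simp [sub_eq_add_neg]

namespace IsPatch

variable {I J : Set ℝ} {X N : ℝ × ℝ → E3} {k : ℝ × ℝ → ℝ} (h : IsPatch I J X N k) {z : ℝ × ℝ}

include h

theorem isOpen : IsOpen (I ×ˢ J) := h.isOpen_fst.prod h.isOpen_snd

theorem diffAt {f : ℝ × ℝ → V} (hf : ContDiffOn ℝ ∞ f (I ×ˢ J)) (hz : z ∈ I ×ˢ J) :
    DifferentiableAt ℝ f z := differentiableAt_of_contDiffOn h.isOpen hf hz

theorem leaf_ne (hz : z ∈ I ×ˢ J) : pd et X z ≠ 0 := fun h0 => by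
  simpa using h.regular z hz et h0

theorem leafSq_pos (hz : z ∈ I ×ˢ J) : 0 < leafSq X z :=
  real_inner_self_pos.2 (h.leaf_ne hz)

theorem cross_ne (hz : z ∈ I ×ˢ J) : cross X z ≠ 0 := fun h0 => by
  simpa using h.regular z hz (1, -shift X z) h0

theorem crossSq_pos (hz : z ∈ I ×ˢ J) : 0 < crossSq X z :=
  real_inner_self_pos.2 (h.cross_ne hz)

theorem normal_ne (hz : z ∈ I ×ˢ J) : N z ≠ 0 := fun h0 => by
  simpa [h0] using h.unit z hz

theorem inner_leaf_cross (hz : z ∈ I ×ˢ J) : ⟪pd et X z, cross X z⟫ = 0 := by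
  rw [cross, nabla_eq, inner_sub_right, real_inner_smul_right, shift, ← leafSq,
    div_mul_cancel₀ _ (h.leafSq_pos hz).ne', real_inner_comm, sub_self]

theorem inner_leaf_normal (hz : z ∈ I ×ˢ J) : ⟪pd et X z, N z⟫ = 0 := by
  rw [real_inner_comm]; exact h.normal z hz et

theorem inner_cross_normal (hz : z ∈ I ×ˢ J) : ⟪cross X z, N z⟫ = 0 := by
  rw [real_inner_comm]; exact h.normal z hz _

theorem ext_inner (hz : z ∈ I ×ˢ J) {v w : E3} (h1 : ⟪v, pd et X z⟫ = ⟪w, pd et X z⟫)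
    (h2 : ⟪v, cross X z⟫ = ⟪w, cross X z⟫) (h3 : ⟪v, N z⟫ = ⟪w, N z⟫) : v = w :=
  eq_of_inner_eq (h.leaf_ne hz) (h.cross_ne hz) (h.normal_ne hz) (h.inner_leaf_cross hz)
    (h.inner_leaf_normal hz) (h.inner_cross_normal hz) h1 h2 h3

theorem smooth_pd {f : ℝ × ℝ → V} (hf : ContDiffOn ℝ ∞ f (I ×ˢ J)) (w : ℝ × ℝ) :
    ContDiffOn ℝ ∞ (pd w f) (I ×ˢ J) := contDiffOn_pd h.isOpen hf

theorem smooth_leafSq : ContDiffOn ℝ ∞ (leafSq X) (I ×ˢ J) :=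
  (h.smooth_pd h.smooth_map et).inner ℝ (h.smooth_pd h.smooth_map et)

theorem smooth_shift : ContDiffOn ℝ ∞ (shift X) (I ×ˢ J) :=
  ((h.smooth_pd h.smooth_map es).inner ℝ (h.smooth_pd h.smooth_map et)).div h.smooth_leafSq
    fun _ hz => (h.leafSq_pos hz).ne'

theorem smooth_nabla {f : ℝ × ℝ → V} (hf : ContDiffOn ℝ ∞ f (I ×ˢ J)) :
    ContDiffOn ℝ ∞ (nabla X f) (I ×ˢ J) :=
  ((h.smooth_pd hf es).sub (h.smooth_shift.smul (h.smooth_pd hf et))).congr fun _ _ => nabla_eq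

theorem smooth_cross : ContDiffOn ℝ ∞ (cross X) (I ×ˢ J) := h.smooth_nabla h.smooth_map

theorem smooth_crossSq : ContDiffOn ℝ ∞ (crossSq X) (I ×ˢ J) :=
  h.smooth_cross.inner ℝ h.smooth_cross

theorem smooth_crossCurv : ContDiffOn ℝ ∞ (crossCurv X N) (I ×ˢ J) :=
  (((h.smooth_nabla h.smooth_normal).inner ℝ h.smooth_cross).div h.smooth_crossSq
    fun _ hz => (h.crossSq_pos hz).ne').neg

theorem smooth_bend : ContDiffOn ℝ ∞ (bend X) (I ×ˢ J) :=
  ((h.smooth_pd h.smooth_cross et).inner ℝ (h.smooth_pd h.smooth_map et)).div h.smooth_leafSq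
    fun _ hz => (h.leafSq_pos hz).ne'

/-- The function `k` carries no regularity of its own; smoothness is recovered by pairing the
curvature line equation with `pd et X`. -/
theorem smooth_curv : ContDiffOn ℝ ∞ k (I ×ˢ J) := by
  have : ContDiffOn ℝ ∞ (fun z => -(⟪pd et N z, pd et X z⟫ / leafSq X z)) (I ×ˢ J) :=
    (((h.smooth_pd h.smooth_normal et).inner ℝ (h.smooth_pd h.smooth_map et)).div h.smooth_leafSq
      fun _ hz => (h.leafSq_pos hz).ne').neg
  refine this.congr fun z hz => ?_
  rw [h.curvature_line z hz, inner_neg_left, real_inner_smul_left, ← leafSq,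
    neg_div, neg_neg, mul_div_cancel_right₀ _ (h.leafSq_pos hz).ne']

/-- The commutator of the derivatives along and across the `t`-curves. -/
theorem pd_nabla {f : ℝ × ℝ → V} (hf : ContDiffOn ℝ ∞ f (I ×ˢ J)) (hz : z ∈ I ×ˢ J) :
    pd et (nabla X f) z = nabla X (pd et f) z - pd et (shift X) z • pd et f z := by
  rw [pd_congr h.isOpen (g := fun z => pd es f z - shift X z • pd et f z)
    (fun _ _ => nabla_eq) hz, pd_sub (h.diffAt (h.smooth_pd hf es) hz)
    ((h.diffAt h.smooth_shift hz).fun_smul (h.diffAt (h.smooth_pd hf et) hz)),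
    pd_smul (h.diffAt h.smooth_shift hz) (h.diffAt (h.smooth_pd hf et) hz), nabla_eq,
    pd_comm h.isOpen hf hz (w := et) (w' := es)]
  abel

theorem nabla_leaf (hz : z ∈ I ×ˢ J) :
    nabla X (pd et X) z = pd et (cross X) z + pd et (shift X) z • pd et X z := by
  have := h.pd_nabla h.smooth_map hz
  rw [show pd et (cross X) z = pd et (nabla X X) z from rfl, this]
  abel

/-- The off-diagonal entry of the second fundamental form. Differentiate `⟪cross X, N⟫ = 0` along
the leaf, where `N` moves only in the leaf direction. -/
theorem inner_pd_cross_normal (hz : z ∈ I ×ˢ J) : ⟪pd et (cross X) z, N z⟫ = 0 := by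
  have h1 := pd_eq_zero_of_eqOn_const (w := et) h.isOpen (fun z hz => h.inner_cross_normal hz) hz
  rw [pd_inner (h.diffAt h.smooth_cross hz) (h.diffAt h.smooth_normal hz), h.curvature_line z hz,
    inner_neg_right, real_inner_smul_right, real_inner_comm (pd et X z),
    h.inner_leaf_cross hz] at h1
  simpa using h1

theorem inner_nabla_normal_leaf (hz : z ∈ I ×ˢ J) : ⟪nabla X N z, pd et X z⟫ = 0 := by
  have h1 := pd_eq_zero_of_eqOn_const (w := (1, -shift X z)) h.isOpen
    (fun z hz => h.inner_leaf_normal hz) hz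
  rw [pd_inner (h.diffAt (h.smooth_pd h.smooth_map et) hz) (h.diffAt h.smooth_normal hz)] at h1
  have h2 := h.nabla_leaf hz
  rw [nabla] at h2
  rw [h2, inner_add_left, real_inner_smul_left, h.inner_pd_cross_normal hz,
    h.inner_leaf_normal hz] at h1
  rw [real_inner_comm, nabla]
  simpa using h1

theorem inner_pd_normal (hz : z ∈ I ×ˢ J) (w : ℝ × ℝ) : ⟪pd w N z, N z⟫ = 0 := by
  have h1 := pd_eq_zero_of_eqOn_const (w := w) h.isOpen h.unit hz
  rw [pd_inner (h.diffAt h.smooth_normal hz) (h.diffAt h.smooth_normal hz),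
    real_inner_comm (pd w N z)] at h1
  linarith

/-- The direction across the `t`-curves is principal, too. -/
theorem nabla_normal (hz : z ∈ I ×ˢ J) :
    nabla X N z = -(crossCurv X N z • cross X z) := by
  apply h.ext_inner hz
  · rw [h.inner_nabla_normal_leaf hz, inner_neg_left, real_inner_smul_left, real_inner_comm,
      h.inner_leaf_cross hz]; simp
  · rw [inner_neg_left, real_inner_smul_left, crossCurv, ← crossSq, neg_mul, neg_neg,
      div_mul_cancel₀ _ (h.crossSq_pos hz).ne']
  · rw [nabla, h.inner_pd_normal hz, inner_neg_left, real_inner_smul_left,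
      h.inner_cross_normal hz]; simp

/-- The commutator formula `pd_nabla`, applied to `N` and rewritten with both principal direction
equations. The formula for `X`, in the form `nabla_leaf`, makes the terms with the derivative of
`shift X` cancel. -/
theorem codazzi (hz : z ∈ I ×ˢ J) :
    (k z - crossCurv X N z) • pd et (cross X) z + nabla X k z • pd et X z
      - pd et (crossCurv X N) z • cross X z = 0 := by
  have h1 := h.pd_nabla h.smooth_normal hz
  rw [pd_congr h.isOpen (fun z hz => h.nabla_normal hz) hz, pd_neg,
    pd_smul (h.diffAt h.smooth_crossCurv hz) (h.diffAt h.smooth_cross hz), h.curvature_line z hz]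
    at h1
  have h2 : nabla X (pd et N) z = -(k z • nabla X (pd et X) z + nabla X k z • pd et X z) := by
    unfold nabla
    rw [pd_congr h.isOpen h.curvature_line hz, pd_neg,
      pd_smul (h.diffAt h.smooth_curv hz) (h.diffAt (h.smooth_pd h.smooth_map et) hz)]
  rw [h2, h.nabla_leaf hz] at h1
  linear_combination (norm := module) h1

theorem bend_mul_leafSq (hz : z ∈ I ×ˢ J) :
    bend X z * leafSq X z = ⟪pd et (cross X) z, pd et X z⟫ :=
  div_mul_cancel₀ _ (h.leafSq_pos hz).ne'

/-- The leaf component of `codazzi`, and the source of the linear equations for the curvatures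
across the leaves. -/
theorem nabla_curv (hz : z ∈ I ×ˢ J) :
    nabla X k z = -((k z - crossCurv X N z) * bend X z) := by
  have h1 := congrArg (fun v => ⟪v, pd et X z⟫) (h.codazzi hz)
  simp only [inner_sub_left, inner_add_left, real_inner_smul_left, inner_zero_left] at h1
  rw [← h.bend_mul_leafSq hz, ← leafSq, real_inner_comm, h.inner_leaf_cross hz] at h1
  apply mul_right_cancel₀ (h.leafSq_pos hz).ne'
  linarith

/-- The component of `codazzi` along `cross X`. Away from umbilics it shows that `cross X` has
constant length on the leaves once the other curvature is constant there. -/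
theorem inner_pd_cross_self (hz : z ∈ I ×ˢ J) :
    (k z - crossCurv X N z) * ⟪pd et (cross X) z, cross X z⟫
      = pd et (crossCurv X N) z * crossSq X z := by
  have h1 := congrArg (fun v => ⟪v, cross X z⟫) (h.codazzi hz)
  simp only [inner_sub_left, inner_add_left, real_inner_smul_left, inner_zero_left] at h1
  rw [h.inner_leaf_cross hz, ← crossSq] at h1
  linarith

theorem inner_pd_leaf_normal (hz : z ∈ I ×ˢ J) :
    ⟪pd et (pd et X) z, N z⟫ = k z * leafSq X z := by
  have h1 := pd_eq_zero_of_eqOn_const (w := et) h.isOpen (fun z hz => h.inner_leaf_normal hz) hz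
  rw [pd_inner (h.diffAt (h.smooth_pd h.smooth_map et) hz) (h.diffAt h.smooth_normal hz),
    h.curvature_line z hz, inner_neg_right, real_inner_smul_right, ← leafSq] at h1
  linarith

theorem inner_pd_leaf_cross (hz : z ∈ I ×ˢ J) :
    ⟪pd et (pd et X) z, cross X z⟫ = -(bend X z * leafSq X z) := by
  have h1 := pd_eq_zero_of_eqOn_const (w := et) h.isOpen (fun z hz => h.inner_leaf_cross hz) hz
  rw [pd_inner (h.diffAt (h.smooth_pd h.smooth_map et) hz) (h.diffAt h.smooth_cross hz),
    real_inner_comm (pd et (cross X) z), ← h.bend_mul_leafSq hz] at h1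
  linarith

theorem hasDerivAt_fst {f : ℝ × ℝ → V} (hf : ContDiffOn ℝ ∞ f (I ×ˢ J)) {s t : ℝ}
    (hz : (s, t) ∈ I ×ˢ J) : HasDerivAt (fun s => f (s, t)) (pd es f (s, t)) s := by
  have h1 : HasFDerivAt (fun s : ℝ => (s, t)) (ContinuousLinearMap.inl ℝ ℝ ℝ) s := by
    exact hasFDerivAt_prodMk_left s t
  have := ((h.diffAt hf hz).hasFDerivAt.comp s h1).hasDerivAt
  simpa [pd, Function.comp_def] using this

theorem hasDerivAt_snd {f : ℝ × ℝ → V} (hf : ContDiffOn ℝ ∞ f (I ×ˢ J)) {s t : ℝ}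
    (hz : (s, t) ∈ I ×ˢ J) : HasDerivAt (fun t => f (s, t)) (pd et f (s, t)) t := by
  have h1 : HasFDerivAt (fun t : ℝ => (s, t)) (ContinuousLinearMap.inr ℝ ℝ ℝ) t := by
    exact hasFDerivAt_prodMk_right s t
  have := ((h.diffAt hf hz).hasFDerivAt.comp t h1).hasDerivAt
  simpa [pd, Function.comp_def] using this

theorem pd_eq_zero_of_slice {f : ℝ × ℝ → V} (hf : ContDiffOn ℝ ∞ f (I ×ˢ J)) {s : ℝ} (hs : s ∈ I) {c : V}
    (h0 : ∀ t ∈ J, f (s, t) = c) : ∀ t ∈ J, pd et f (s, t) = 0 := by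
  intro t ht
  have h1 := h.hasDerivAt_snd hf (s := s) (t := t) ⟨hs, ht⟩
  have h2 : (fun t => f (s, t)) =ᶠ[nhds t] fun _ => c :=
    Filter.eventually_of_mem (h.isOpen_snd.mem_nhds ht) h0
  exact h1.unique ((hasDerivAt_const t _).congr_of_eventuallyEq h2)

theorem eq_of_pd_eq_zero_slice {f : ℝ × ℝ → V} (hf : ContDiffOn ℝ ∞ f (I ×ˢ J)) {s : ℝ} (hs : s ∈ I)
    (h0 : ∀ t ∈ J, pd et f (s, t) = 0) {t t' : ℝ} (ht : t ∈ J) (ht' : t' ∈ J) :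
    f (s, t) = f (s, t') := by
  have := eq_zero_of_norm_deriv_le (f := fun t => f (s, t) - f (s, t')) (c := fun _ => 0)
    h.ordConnected_snd
    (fun t ht => (h.hasDerivAt_snd hf (t := t) ⟨hs, ht⟩).sub_const _) continuousOn_const
    (fun t ht => by rw [h0 t ht]; simp) ht' (by simp) t ht
  exact sub_eq_zero.1 this

theorem eq_of_pd_eq_zero {f : ℝ × ℝ → V} (hf : ContDiffOn ℝ ∞ f (I ×ˢ J))
    (h0 : ∀ z ∈ I ×ˢ J, pd et f z = 0) {s t t' : ℝ} (hz : (s, t) ∈ I ×ˢ J)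
    (hz' : (s, t') ∈ I ×ˢ J) : f (s, t) = f (s, t') :=
  h.eq_of_pd_eq_zero_slice hf hz.1 (fun _ ht => h0 _ ⟨hz.1, ht⟩) hz.2 hz'.2

theorem pd_eq_zero_of_eq {f : ℝ × ℝ → V} (hf : ContDiffOn ℝ ∞ f (I ×ˢ J))
    (h0 : ∀ s t t', (s, t) ∈ I ×ˢ J → (s, t') ∈ I ×ˢ J → f (s, t) = f (s, t'))
    (hz : z ∈ I ×ˢ J) : pd et f z = 0 :=
  h.pd_eq_zero_of_slice hf hz.1 (fun t ht => h0 z.1 t z.2 ⟨hz.1, ht⟩ hz) z.2 hz.2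

/-- A function that is constant along the `t`-curves and satisfies a linear differential
inequality across them vanishes identically if it vanishes at one point. -/
theorem eq_zero_of_norm_nabla_le {f : ℝ × ℝ → V} {c : ℝ × ℝ → ℝ}
    (hf : ContDiffOn ℝ ∞ f (I ×ˢ J)) (h0 : ∀ z ∈ I ×ˢ J, pd et f z = 0)
    (hc : ContinuousOn c (I ×ˢ J)) (hle : ∀ z ∈ I ×ˢ J, ‖nabla X f z‖ ≤ c z * ‖f z‖)
    (hz : z ∈ I ×ˢ J) (hfz : f z = 0) {y : ℝ × ℝ} (hy : y ∈ I ×ˢ J) : f y = 0 := by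
  obtain ⟨s₀, t₀⟩ := z
  obtain ⟨s, t⟩ := y
  -- As the domain is a rectangle, one can slide along a leaf to the line `t = t₀`. On that line
  -- `nabla X f` is just the `s`-derivative, because `pd et f = 0`.
  rw [h.eq_of_pd_eq_zero hf h0 hy (⟨hy.1, hz.2⟩ : (s, t₀) ∈ I ×ˢ J)]
  refine eq_zero_of_norm_deriv_le (f := fun s => f (s, t₀)) (c := fun s => c (s, t₀))
    h.ordConnected_fst (fun s hs => h.hasDerivAt_fst hf ⟨hs, hz.2⟩)
    (hc.comp (by fun_prop) fun s hs => ⟨hs, hz.2⟩) (fun s hs => ?_) hz.1 hfz s hy.1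
  have h1 := hle (s, t₀) ⟨hs, hz.2⟩
  rwa [nabla_eq, h0 (s, t₀) ⟨hs, hz.2⟩, smul_zero, sub_zero] at h1

end IsPatch

end Patch

/-! ### The Weingarten relation on a patch -/

namespace IsPatch

section Weingarten

variable {I J : Set ℝ} {X N : ℝ × ℝ → E3} {k : ℝ × ℝ → ℝ} (h : IsPatch I J X N k)
  (hk : ∀ z ∈ I ×ˢ J, pd et k z = 0) {a b c : ℝ}
  (hW : ∀ z ∈ I ×ˢ J, a * (k z * crossCurv X N z) + b * (k z + crossCurv X N z) + c = 0)
  {z y : ℝ × ℝ}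

include hW in
theorem weingarten_mul (hz : z ∈ I ×ˢ J) :
    (a * k z + b) * (a * crossCurv X N z + b) = b ^ 2 - a * c := by
  linear_combination a * hW z hz

include hW in
theorem weingarten_ne (hd : b ^ 2 - a * c ≠ 0) (hz : z ∈ I ×ˢ J) : a * k z + b ≠ 0 := by
  intro h0
  rw [← weingarten_mul hW hz, h0, zero_mul] at hd
  exact hd rfl

include h hW in
theorem weingarten_pd (hz : z ∈ I ×ˢ J) (w : ℝ × ℝ) :
    pd w k z * (a * crossCurv X N z + b) + pd w (crossCurv X N) z * (a * k z + b) = 0 := by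
  have h1 := pd_eq_zero_of_eqOn_const (w := w) (c := (0 : ℝ)) h.isOpen hW hz
  have hkd := h.diffAt h.smooth_curv hz
  have hld := h.diffAt h.smooth_crossCurv hz
  unfold pd at h1 ⊢
  rw [fderiv_add_const, fderiv_fun_add (by fun_prop) (by fun_prop),
    fderiv_const_mul (by fun_prop), fderiv_const_mul (by fun_prop), fderiv_fun_mul hkd hld,
    fderiv_fun_add hkd hld] at h1
  simp at h1
  linear_combination h1

-- In the derivative of the relation along a leaf the term with `pd et k` drops out, and the
-- remaining coefficient `a * k z + b` is nonzero by the product form of the relation.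
include h hk hW in
theorem pd_crossCurv (hd : b ^ 2 - a * c ≠ 0) (hz : z ∈ I ×ˢ J) :
    pd et (crossCurv X N) z = 0 := by
  have := h.weingarten_pd hW hz et
  rw [hk z hz, zero_mul, zero_add] at this
  exact (mul_eq_zero.1 this).resolve_right (weingarten_ne hW hd hz)

include h hW in
theorem nabla_crossCurv (hd : b ^ 2 - a * c ≠ 0) (hz : z ∈ I ×ˢ J) :
    nabla X (crossCurv X N) z =
      (k z - crossCurv X N z) * bend X z * ((a * crossCurv X N z + b) / (a * k z + b)) := by
  have h1 := h.weingarten_pd hW hz (1, -shift X z)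
  have h2 := h.nabla_curv hz
  have h3 := weingarten_ne hW hd hz
  unfold nabla at *
  rw [h2] at h1
  rw [← mul_div_assoc, eq_div_iff h3]
  linear_combination h1

include h hW in
theorem continuousOn_ratio (hd : b ^ 2 - a * c ≠ 0) :
    ContinuousOn (fun z => (a * crossCurv X N z + b) / (a * k z + b)) (I ×ˢ J) :=
  ((continuousOn_const.mul h.smooth_crossCurv.continuousOn).add continuousOn_const).div
    ((continuousOn_const.mul h.smooth_curv.continuousOn).add continuousOn_const)
    fun _ hz => weingarten_ne hW hd hz

-- With `l` the other curvature, the difference `k - l` is constant on the leaves, and `nabla_curv`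
-- together with `nabla_crossCurv` gives `∇(k - l) = -(k - l) β (1 + (a l + b) / (a k + b))`, a
-- linear equation.
include h hk hW in
theorem umbilic_of_umbilic (hd : b ^ 2 - a * c ≠ 0) (hz : z ∈ I ×ˢ J)
    (h0 : k z = crossCurv X N z) (hy : y ∈ I ×ˢ J) : k y = crossCurv X N y := by
  rw [← sub_eq_zero]
  refine h.eq_zero_of_norm_nabla_le (f := fun z => k z - crossCurv X N z)
    (c := fun z => ‖bend X z * (1 + (a * crossCurv X N z + b) / (a * k z + b))‖)
    (h.smooth_curv.sub h.smooth_crossCurv) (fun z hz => ?_)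
    (h.smooth_bend.continuousOn.mul
      (continuousOn_const.add (h.continuousOn_ratio hW hd))).norm
    (fun z hz => ?_) hz (sub_eq_zero.2 h0) hy
  · rw [pd_sub (h.diffAt h.smooth_curv hz) (h.diffAt h.smooth_crossCurv hz), hk z hz,
      h.pd_crossCurv hk hW hd hz, sub_zero]
  · have : nabla X (fun z => k z - crossCurv X N z) z = nabla X k z - nabla X (crossCurv X N) z :=
      pd_sub (h.diffAt h.smooth_curv hz) (h.diffAt h.smooth_crossCurv hz)
    rw [this, h.nabla_curv hz, h.nabla_crossCurv hW hd hz, ← norm_mul]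
    apply le_of_eq
    rw [← norm_neg]
    congr 1
    ring

-- Here the other curvature `l` need not be constant on the leaves, but an equation for `k` alone
-- suffices. Where `l = κ`, `nabla_curv` reads `∇k = -(k - κ) β`; where `l ≠ κ`, `k` is locally
-- equal to `κ` and `∇k = 0`.
include h hk in
theorem curv_eq_const_of_eq {κ : ℝ}
    (hκ : ∀ z ∈ I ×ˢ J, (k z - κ) * (crossCurv X N z - κ) = 0) (hz : z ∈ I ×ˢ J)
    (h0 : k z = κ) (hy : y ∈ I ×ˢ J) : k y = κ := by
  rw [← sub_eq_zero]
  have hf : ContDiffOn ℝ ∞ (fun z => k z - κ) (I ×ˢ J) := h.smooth_curv.sub contDiffOn_const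
  have hpd : ∀ z w, pd w (fun z => k z - κ) z = pd w k z := fun z w => by
    rw [pd_sub_const]
  refine h.eq_zero_of_norm_nabla_le (f := fun z => k z - κ) (c := fun z => ‖bend X z‖) hf
    (fun z hz => by rw [hpd, hk z hz]) h.smooth_bend.continuousOn.norm
    (fun z hz => ?_) hz (sub_eq_zero.2 h0) hy
  rw [← norm_mul]
  have hn : nabla X (fun z => k z - κ) z = nabla X k z := hpd z _
  rcases mul_eq_zero.1 (hκ z hz) with h1 | h1
  · suffices nabla X (fun z => k z - κ) z = 0 by rw [this, norm_zero]; positivity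
    by_cases h2 : crossCurv X N z = κ
    · rw [hn, h.nabla_curv hz, h2, h1]; simp
    · have hc : ContinuousAt (crossCurv X N) z :=
        h.smooth_crossCurv.continuousOn.continuousAt (h.isOpen.mem_nhds hz)
      have : (fun z => k z - κ) =ᶠ[nhds z] fun _ => 0 := by
        filter_upwards [hc.eventually_ne h2, h.isOpen.mem_nhds hz] with y hy hyB
        exact (mul_eq_zero.1 (hκ y hyB)).resolve_right (sub_ne_zero.2 hy)
      unfold nabla pd
      rw [this.fderiv_eq]; simp
  · rw [hn, h.nabla_curv hz, sub_eq_zero.1 h1, norm_neg, mul_comm]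

end Weingarten

/-! ### Structure equations when both curvatures are constant on the leaves, without umbilics -/

section Revolution

variable {I J : Set ℝ} {X N : ℝ × ℝ → E3} {k : ℝ × ℝ → ℝ} (h : IsPatch I J X N k)
  (hk : ∀ z ∈ I ×ˢ J, pd et k z = 0) (hl : ∀ z ∈ I ×ˢ J, pd et (crossCurv X N) z = 0)
  (hne : ∀ z ∈ I ×ˢ J, k z ≠ crossCurv X N z) {z y : ℝ × ℝ}

include h hl hne

theorem inner_pd_cross_cross (hz : z ∈ I ×ˢ J) : ⟪pd et (cross X) z, cross X z⟫ = 0 := by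
  have := h.inner_pd_cross_self hz
  rw [hl z hz, zero_mul] at this
  exact (mul_eq_zero.1 this).resolve_left (sub_ne_zero.2 (hne z hz))

theorem pd_cross (hz : z ∈ I ×ˢ J) : pd et (cross X) z = bend X z • pd et X z := by
  apply h.ext_inner hz
  · rw [real_inner_smul_left, ← leafSq, h.bend_mul_leafSq hz]
  · rw [h.inner_pd_cross_cross hl hne hz, real_inner_smul_left, h.inner_leaf_cross hz, mul_zero]
  · rw [h.inner_pd_cross_normal hz, real_inner_smul_left, h.inner_leaf_normal hz, mul_zero]

theorem pd_crossSq (hz : z ∈ I ×ˢ J) : pd et (crossSq X) z = 0 := by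
  have : pd et (crossSq X) z = ⟪pd et (cross X) z, cross X z⟫ + ⟪cross X z, pd et (cross X) z⟫ :=
    pd_inner (h.diffAt h.smooth_cross hz) (h.diffAt h.smooth_cross hz)
  rw [this, real_inner_comm (pd et (cross X) z), h.inner_pd_cross_cross hl hne hz, add_zero]

theorem nabla_leaf_eq (hz : z ∈ I ×ˢ J) :
    nabla X (pd et X) z = (bend X z + pd et (shift X) z) • pd et X z := by
  rw [h.nabla_leaf hz, h.pd_cross hl hne hz, add_smul]

/-- There is no leaf component because `nabla X (pd et X)` is parallel to the leaf: up to
parametrization, the orthogonal trajectories of the leaves are geodesics. -/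
theorem nabla_cross (hz : z ∈ I ×ˢ J) : nabla X (cross X) z =
    (nabla X (crossSq X) z / (2 * crossSq X z)) • cross X z
      + (crossCurv X N z * crossSq X z) • N z := by
  have hG := (h.crossSq_pos hz).ne'
  have hqd := h.diffAt h.smooth_cross hz
  apply h.ext_inner hz
  · have h1 := pd_eq_zero_of_eqOn_const (w := (1, -shift X z)) h.isOpen
      (fun z hz => h.inner_leaf_cross hz) hz
    rw [pd_inner (h.diffAt (h.smooth_pd h.smooth_map et) hz) hqd] at h1
    have h2 := h.nabla_leaf_eq hl hne hz
    unfold nabla at h2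
    rw [h2, real_inner_smul_left, h.inner_leaf_cross hz, mul_zero, zero_add] at h1
    rw [real_inner_comm, nabla, h1, inner_add_left, real_inner_smul_left, real_inner_smul_left,
      real_inner_comm (pd et X z), real_inner_comm (pd et X z), h.inner_leaf_cross hz,
      h.inner_leaf_normal hz]
    simp
  · have : nabla X (crossSq X) z
        = ⟪nabla X (cross X) z, cross X z⟫ + ⟪cross X z, nabla X (cross X) z⟫ :=
      pd_inner hqd hqd
    rw [this, inner_add_left, real_inner_smul_left, real_inner_smul_left,
      real_inner_comm (cross X z) (N z), h.inner_cross_normal hz, ← crossSq,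
      real_inner_comm (nabla X (cross X) z) (cross X z)]
    field_simp
    ring
  · have h1 := pd_eq_zero_of_eqOn_const (w := (1, -shift X z)) h.isOpen
      (fun z hz => h.inner_cross_normal hz) hz
    rw [pd_inner hqd (h.diffAt h.smooth_normal hz)] at h1
    have h2 := h.nabla_normal hz
    unfold nabla at h2
    rw [h2, inner_neg_right, real_inner_smul_right, ← crossSq] at h1
    rw [inner_add_left, real_inner_smul_left, real_inner_smul_left, h.inner_cross_normal hz,
      h.unit z hz, nabla]
    linarith

/-- The Gauss equation. -/
theorem nabla_bend (hz : z ∈ I ×ˢ J) : nabla X (bend X) z =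
    (-bend X z + nabla X (crossSq X) z / (2 * crossSq X z)) * bend X z
      - crossSq X z * (k z * crossCurv X N z) := by
  have hpd := h.diffAt (h.smooth_pd h.smooth_map et) hz
  have h1 := h.pd_nabla h.smooth_cross hz
  have h2 : nabla X (pd et (cross X)) z
      = bend X z • nabla X (pd et X) z + nabla X (bend X) z • pd et X z := by
    unfold nabla
    rw [pd_congr h.isOpen (fun z hz => h.pd_cross hl hne hz) hz, pd_smul (h.diffAt h.smooth_bend hz)
      hpd]
  rw [h2, h.nabla_leaf_eq hl hne hz, h.pd_cross hl hne hz] at h1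
  have h3 : ∀ z ∈ I ×ˢ J, ⟪nabla X (cross X) z, pd et X z⟫ = 0 := fun z hz => by
    rw [h.nabla_cross hl hne hz, inner_add_left, real_inner_smul_left, real_inner_smul_left,
      real_inner_comm (pd et X z), real_inner_comm (pd et X z), h.inner_leaf_cross hz,
      h.inner_leaf_normal hz]
    simp
  -- Differentiating the vanishing leaf component of `nabla X (cross X)` along the leaf gives the
  -- Gauss equation, multiplied by `leafSq X z`.
  have h4 := pd_eq_zero_of_eqOn_const (w := et) h.isOpen h3 hz
  rw [pd_inner (h.diffAt (h.smooth_nabla h.smooth_cross) hz) hpd, h1, h.nabla_cross hl hne hz] at h4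
  simp only [inner_add_left, inner_sub_left, real_inner_smul_left] at h4
  rw [← leafSq, real_inner_comm (pd et (pd et X) z), real_inner_comm (pd et (pd et X) z),
    h.inner_pd_leaf_cross hz, h.inner_pd_leaf_normal hz] at h4
  apply mul_right_cancel₀ (h.leafSq_pos hz).ne'
  linear_combination h4

include hk

/-- Since `pd et k = 0`, the commutator formula makes `nabla X k = -(k - l) β` constant on the
leaves, and `k - l` is constant there and nonzero. -/
theorem pd_bend (hz : z ∈ I ×ˢ J) : pd et (bend X) z = 0 := by
  have hkd := h.diffAt h.smooth_curv hz
  have hld := h.diffAt h.smooth_crossCurv hz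
  have h1 := h.pd_nabla h.smooth_curv hz
  rw [hk z hz, smul_zero, sub_zero, nabla, pd_eq_zero_of_eqOn_const h.isOpen hk hz,
    pd_congr h.isOpen (fun z hz => h.nabla_curv hz) hz, pd_neg,
    pd_mul (by fun_prop) (h.diffAt h.smooth_bend hz), pd_sub hkd hld, hk z hz, hl z hz] at h1
  have h2 : (k z - crossCurv X N z) * pd et (bend X) z = 0 := by linarith
  exact (mul_eq_zero.1 h2).resolve_left (sub_ne_zero.2 (hne z hz))

end Revolution

end IsPatch

theorem pd_prodMk {V W : Type*} [NormedAddCommGroup V] [NormedSpace ℝ V] [NormedAddCommGroup W]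
    [NormedSpace ℝ W] {f : ℝ × ℝ → V} {g : ℝ × ℝ → W} {z w : ℝ × ℝ}
    (hf : DifferentiableAt ℝ f z) (hg : DifferentiableAt ℝ g z) :
    pd w (fun y => (f y, g y)) z = (pd w f z, pd w g z) := by
  unfold pd
  rw [hf.fderiv_prodMk hg]; rfl

theorem pd_clm_comp {V W : Type*} [NormedAddCommGroup V] [NormedSpace ℝ V] [NormedAddCommGroup W]
    [NormedSpace ℝ W] (L : V →L[ℝ] W) {f : ℝ × ℝ → V} {z w : ℝ × ℝ}
    (hf : DifferentiableAt ℝ f z) : pd w (fun y => L (f y)) z = L (pd w f z) := by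
  unfold pd
  rw [show (fun y => L (f y)) = L ∘ f from rfl, fderiv_comp _ L.differentiableAt hf, L.fderiv]
  rfl

namespace IsPatch

/-! ### Propagation of flatness across the leaves -/

section Flat

variable {I J : Set ℝ} {X N : ℝ × ℝ → E3} {k : ℝ × ℝ → ℝ} (h : IsPatch I J X N k)
  (hk : ∀ z ∈ I ×ˢ J, pd et k z = 0) {a b c : ℝ}
  (hW : ∀ z ∈ I ×ˢ J, a * (k z * crossCurv X N z) + b * (k z + crossCurv X N z) + c = 0)
  (hd : b ^ 2 - a * c ≠ 0)
  (hne : ∀ z ∈ I ×ˢ J, k z ≠ crossCurv X N z) {z y : ℝ × ℝ}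

include h hk hW hd hne

/-- The pair `(K, β)` solves a homogeneous linear system: `∇K` is a multiple of `β` by the Codazzi
equation and the Weingarten relation, and `∇β` is a combination of `β` and `K` by the Gauss
equation. -/
theorem flat_of_flat_of_bend_eq_zero (hz : z ∈ I ×ˢ J) (h0 : k z * crossCurv X N z = 0)
    (hb : bend X z = 0) (hy : y ∈ I ×ˢ J) : k y * crossCurv X N y = 0 := by
  have hl : ∀ z ∈ I ×ˢ J, pd et (crossCurv X N) z = 0 := fun z hz => h.pd_crossCurv hk hW hd hz
  have hKs : ContDiffOn ℝ ∞ (fun z => k z * crossCurv X N z) (I ×ˢ J) :=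
    h.smooth_curv.mul h.smooth_crossCurv
  have hns := h.smooth_nabla h.smooth_crossSq
  have hKpd : ∀ z ∈ I ×ˢ J, ∀ w, pd w (fun z => k z * crossCurv X N z) z =
      k z * pd w (crossCurv X N) z + pd w k z * crossCurv X N z := fun z hz w =>
    pd_mul (h.diffAt h.smooth_curv hz) (h.diffAt h.smooth_crossCurv hz)
  have hKn : ∀ z ∈ I ×ˢ J, nabla X (fun z => k z * crossCurv X N z) z =
      ((k z - crossCurv X N z) *
        (k z * ((a * crossCurv X N z + b) / (a * k z + b)) - crossCurv X N z)) * bend X z := by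
    intro z hz
    rw [show nabla X (fun z => k z * crossCurv X N z) z =
      k z * nabla X (crossCurv X N) z + nabla X k z * crossCurv X N z from hKpd z hz _,
      h.nabla_curv hz, h.nabla_crossCurv hW hd hz]
    ring
  have := h.eq_zero_of_norm_nabla_le (f := fun z => (k z * crossCurv X N z, bend X z))
    (c := fun z => ‖(k z - crossCurv X N z) *
        (k z * ((a * crossCurv X N z + b) / (a * k z + b)) - crossCurv X N z)‖ +
      ‖-bend X z + nabla X (crossSq X) z / (2 * crossSq X z)‖ + ‖crossSq X z‖)
    (hKs.prodMk h.smooth_bend) (fun z hz => ?_) ?_ (fun z hz => ?_) hz (Prod.ext h0 hb) hy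
  · exact congrArg Prod.fst this
  · rw [pd_prodMk (h.diffAt hKs hz) (h.diffAt h.smooth_bend hz), hKpd z hz, hk z hz, hl z hz,
      h.pd_bend hk hl hne hz]
    simp
  · have ck := h.smooth_curv.continuousOn
    have cl := h.smooth_crossCurv.continuousOn
    have cb := h.smooth_bend.continuousOn
    have cg := h.smooth_crossSq.continuousOn
    refine (((ck.sub cl).mul ((ck.mul (h.continuousOn_ratio hW hd)).sub cl)).norm.add
      (cb.neg.add (hns.continuousOn.div (continuousOn_const.mul cg) fun z hz => ?_)).norm).add
      cg.norm
    exact mul_ne_zero two_ne_zero (h.crossSq_pos hz).ne'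
  · have hn : nabla X (fun z => (k z * crossCurv X N z, bend X z)) z
        = (nabla X (fun z => k z * crossCurv X N z) z, nabla X (bend X) z) :=
      pd_prodMk (h.diffAt hKs hz) (h.diffAt h.smooth_bend hz)
    rw [hn, hKn z hz, h.nabla_bend hl hne hz, Prod.norm_mk]
    set K := k z * crossCurv X N z
    set m₁ := (k z - crossCurv X N z) *
        (k z * ((a * crossCurv X N z + b) / (a * k z + b)) - crossCurv X N z)
    set m₂ := -bend X z + nabla X (crossSq X) z / (2 * crossSq X z)
    have e1 : ‖K‖ ≤ ‖(K, bend X z)‖ := norm_fst_le (K, bend X z)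
    have e2 : ‖bend X z‖ ≤ ‖(K, bend X z)‖ := norm_snd_le (K, bend X z)
    set n := ‖(K, bend X z)‖
    have hn0 : 0 ≤ n := norm_nonneg _
    have p1 := norm_nonneg m₁
    have p2 := norm_nonneg m₂
    have p3 := norm_nonneg (crossSq X z)
    apply max_le
    · rw [norm_mul]
      nlinarith [mul_le_mul_of_nonneg_left e2 p1, mul_nonneg p2 hn0, mul_nonneg p3 hn0]
    · refine (norm_sub_le _ _).trans ?_
      rw [norm_mul, norm_mul]
      nlinarith [mul_le_mul_of_nonneg_left e2 p2, mul_le_mul_of_nonneg_left e1 p3,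
        mul_nonneg p1 hn0]

-- In the absence of umbilics exactly one curvature vanishes at `z`. If it is `k`, then `k = 0` near
-- `z`; if it is the other one, the relation reduces to `b k + c = 0` with `b ≠ 0`. Either way `k`
-- is locally constant, and `nabla_curv` forces `β = 0`.
omit hk in
theorem bend_eq_zero_of_eventually_flat (hz : z ∈ I ×ˢ J)
    (h0 : ∀ᶠ y in nhds z, k y * crossCurv X N y = 0) : bend X z = 0 := by
  have ck : ContinuousAt k z := h.smooth_curv.continuousOn.continuousAt (h.isOpen.mem_nhds hz)
  have cl : ContinuousAt (crossCurv X N) z :=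
    h.smooth_crossCurv.continuousOn.continuousAt (h.isOpen.mem_nhds hz)
  have hB := h.isOpen.mem_nhds hz
  suffices hs : ∃ κ, ∀ᶠ y in nhds z, k y = κ by
    obtain ⟨κ, hκ⟩ := hs
    have h1 : nabla X k z = 0 := by
      have : k =ᶠ[nhds z] fun _ => κ := hκ
      unfold nabla pd
      rw [this.fderiv_eq]; simp
    rw [h.nabla_curv hz, neg_eq_zero] at h1
    exact (mul_eq_zero.1 h1).resolve_left (sub_ne_zero.2 (hne z hz))
  by_cases hkz : k z = 0
  · refine ⟨0, ?_⟩
    have hlz : crossCurv X N z ≠ 0 := fun hlz => hne z hz (hkz.trans hlz.symm)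
    filter_upwards [h0, cl.eventually_ne hlz] with y hy hly
    exact (mul_eq_zero.1 hy).resolve_right hly
  · have h1 : ∀ᶠ y in nhds z, b * k y + c = 0 := by
      filter_upwards [h0, ck.eventually_ne hkz, hB] with y hy hky hyB
      have h2 := hW y hyB
      have h3 := (mul_eq_zero.1 hy).resolve_left hky
      rw [h3] at h2
      linarith
    have hb : b ≠ 0 := by
      rintro rfl
      have := h1.self_of_nhds
      apply hd
      linear_combination (-a) * this
    refine ⟨-c / b, ?_⟩
    filter_upwards [h1] with y hy
    rw [eq_div_iff hb]
    linarith

theorem flat_of_eventually_flat (hz : z ∈ I ×ˢ J)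
    (h0 : ∀ᶠ y in nhds z, k y * crossCurv X N y = 0) (hy : y ∈ I ×ˢ J) :
    k y * crossCurv X N y = 0 :=
  h.flat_of_flat_of_bend_eq_zero hk hW hd hne hz h0.self_of_nhds
    (h.bend_eq_zero_of_eventually_flat hW hd hne hz h0) hy

end Flat

/-! ### The common axis of the leaves in a patch -/

section Axis

variable {I J : Set ℝ} {X N : ℝ × ℝ → E3} {k : ℝ × ℝ → ℝ} (h : IsPatch I J X N k)
  (hk : ∀ z ∈ I ×ˢ J, pd et k z = 0) (hl : ∀ z ∈ I ×ˢ J, pd et (crossCurv X N) z = 0)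
  (hne : ∀ z ∈ I ×ˢ J, k z ≠ crossCurv X N z)
  (hkb : ∀ z ∈ I ×ˢ J, k z ≠ 0 ∨ bend X z ≠ 0) {z y : ℝ × ℝ}

/-- A vector in the direction of the axis of the circular `t`-curves. -/
noncomputable def axisDir (X N : ℝ × ℝ → E3) (k : ℝ × ℝ → ℝ) (z : ℝ × ℝ) : E3 :=
  k z • cross X z + bend X z • N z

/-- The principal normal of the `t`-curves, up to a factor. -/
noncomputable def axisNormal (X N : ℝ × ℝ → E3) (k : ℝ × ℝ → ℝ) (z : ℝ × ℝ) : E3 :=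
  (k z * crossSq X z) • N z - bend X z • cross X z

/-- The squared length of the axis direction. -/
noncomputable def axisSq (X : ℝ × ℝ → E3) (k : ℝ × ℝ → ℝ) (z : ℝ × ℝ) : ℝ :=
  k z * k z * crossSq X z + bend X z * bend X z

/-- A point on the axis of the circular `t`-curves. -/
noncomputable def axisPoint (X N : ℝ × ℝ → E3) (k : ℝ × ℝ → ℝ) (z : ℝ × ℝ) : E3 :=
  X z + (axisSq X k z)⁻¹ • axisNormal X N k z

include h

theorem inner_axisDir_leaf (hz : z ∈ I ×ˢ J) : ⟪axisDir X N k z, pd et X z⟫ = 0 := by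
  rw [axisDir, inner_add_left, real_inner_smul_left, real_inner_smul_left,
    real_inner_comm (pd et X z), real_inner_comm (pd et X z), h.inner_leaf_cross hz,
    h.inner_leaf_normal hz]
  simp

theorem inner_axisNormal_leaf (hz : z ∈ I ×ˢ J) : ⟪axisNormal X N k z, pd et X z⟫ = 0 := by
  rw [axisNormal, inner_sub_left, real_inner_smul_left, real_inner_smul_left,
    real_inner_comm (pd et X z), real_inner_comm (pd et X z), h.inner_leaf_cross hz,
    h.inner_leaf_normal hz]
  simp

theorem smooth_axisDir : ContDiffOn ℝ ∞ (axisDir X N k) (I ×ˢ J) :=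
  (h.smooth_curv.smul h.smooth_cross).add (h.smooth_bend.smul h.smooth_normal)

theorem smooth_axisNormal : ContDiffOn ℝ ∞ (axisNormal X N k) (I ×ˢ J) :=
  ((h.smooth_curv.mul h.smooth_crossSq).smul h.smooth_normal).sub
    (h.smooth_bend.smul h.smooth_cross)

theorem smooth_axisSq : ContDiffOn ℝ ∞ (axisSq X k) (I ×ˢ J) :=
  ((h.smooth_curv.mul h.smooth_curv).mul h.smooth_crossSq).add (h.smooth_bend.mul h.smooth_bend)

theorem inner_sub_axisPoint (hz : z ∈ I ×ˢ J) : ⟪X z - axisPoint X N k z, pd et X z⟫ = 0 := by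
  rw [axisPoint, sub_add_cancel_left, inner_neg_left, real_inner_smul_left,
    h.inner_axisNormal_leaf hz]
  simp

include hkb

theorem axisSq_pos (hz : z ∈ I ×ˢ J) : 0 < axisSq X k z := by
  have hG := h.crossSq_pos hz
  have h1 : 0 ≤ k z * k z * crossSq X z := mul_nonneg (mul_self_nonneg _) hG.le
  have h2 : 0 ≤ bend X z * bend X z := mul_self_nonneg _
  rw [axisSq]
  rcases hkb z hz with h0 | h0
  · have := mul_pos (mul_self_pos.2 h0) hG
    linarith
  · have := mul_self_pos.2 h0
    linarith

theorem axisDir_ne (hz : z ∈ I ×ˢ J) : axisDir X N k z ≠ 0 := by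
  intro h0
  have h1 := congrArg (fun v => ⟪v, N z⟫) h0
  have h2 := congrArg (fun v => ⟪v, cross X z⟫) h0
  simp only [axisDir, inner_add_left, real_inner_smul_left, inner_zero_left,
    h.inner_cross_normal hz, h.unit z hz, real_inner_comm (cross X z) (N z)] at h1 h2
  rw [← crossSq] at h2
  have h3 := h.crossSq_pos hz
  rcases hkb z hz with h4 | h4
  · simp [h4, h3.ne'] at h2
  · simp [h4] at h1

theorem axisNormal_ne (hz : z ∈ I ×ˢ J) : axisNormal X N k z ≠ 0 := by
  intro h0
  have h1 := congrArg (fun v => ⟪v, N z⟫) h0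
  have h2 := congrArg (fun v => ⟪v, cross X z⟫) h0
  simp only [axisNormal, inner_sub_left, real_inner_smul_left, inner_zero_left,
    h.inner_cross_normal hz, h.unit z hz, real_inner_comm (cross X z) (N z)] at h1 h2
  rw [← crossSq] at h2
  have h3 := h.crossSq_pos hz
  rcases hkb z hz with h4 | h4
  · simp [h4, h3.ne'] at h1
  · simp [h4, h3.ne'] at h2

theorem smooth_axisPoint : ContDiffOn ℝ ∞ (axisPoint X N k) (I ×ˢ J) :=
  h.smooth_map.add ((h.smooth_axisSq.inv fun _ hz => (h.axisSq_pos hkb hz).ne').smul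
    h.smooth_axisNormal)

/-- The axis direction is the binormal direction of the `t`-curves. -/
theorem eq_smul_axisDir {v : E3} (hz : z ∈ I ×ˢ J) (h1 : ⟪v, pd et X z⟫ = 0)
    (h2 : ⟪v, pd et (pd et X) z⟫ = 0) : ∃ m : ℝ, v = m • axisDir X N k z := by
  have hE := (h.leafSq_pos hz).ne'
  have hG := (h.crossSq_pos hz).ne'
  have hA : ⟪axisDir X N k z, axisDir X N k z⟫ ≠ 0 :=
    (real_inner_self_pos.2 (h.axisDir_ne hkb hz)).ne'
  -- The acceleration of a leaf lies in the span of `pd et X` and `axisNormal`, so a vector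
  -- orthogonal to velocity and acceleration is orthogonal to both and thus parallel to `axisDir`.
  have hd : pd et (pd et X) z = (⟪pd et (pd et X) z, pd et X z⟫ / leafSq X z) • pd et X z +
      (leafSq X z / crossSq X z) • axisNormal X N k z := by
    apply h.ext_inner hz
    · rw [inner_add_left, real_inner_smul_left, real_inner_smul_left,
        h.inner_axisNormal_leaf hz, ← leafSq, div_mul_cancel₀ _ hE]
      simp
    · rw [h.inner_pd_leaf_cross hz, axisNormal]
      simp only [inner_add_left, inner_sub_left, real_inner_smul_left]
      rw [h.inner_leaf_cross hz, real_inner_comm (cross X z), h.inner_cross_normal hz, ← crossSq]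
      field_simp
      ring
    · rw [h.inner_pd_leaf_normal hz, axisNormal]
      simp only [inner_add_left, inner_sub_left, real_inner_smul_left]
      rw [h.inner_leaf_normal hz, h.inner_cross_normal hz, h.unit z hz]
      field_simp
      ring
  have h3 : ⟪v, axisNormal X N k z⟫ = 0 := by
    rw [hd, inner_add_right, real_inner_smul_right, real_inner_smul_right, h1, mul_zero,
      zero_add] at h2
    exact (mul_eq_zero.1 h2).resolve_left (div_ne_zero hE hG)
  have h4 : ⟪axisDir X N k z, axisNormal X N k z⟫ = 0 := by
    rw [axisDir, axisNormal]
    simp only [inner_add_left, inner_sub_right, real_inner_smul_left, real_inner_smul_right]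
    rw [h.inner_cross_normal hz, real_inner_comm (cross X z) (N z), h.inner_cross_normal hz,
      ← crossSq, h.unit z hz]
    ring
  refine ⟨⟪v, axisDir X N k z⟫ / ⟪axisDir X N k z, axisDir X N k z⟫, ?_⟩
  apply eq_of_inner_eq (h.leaf_ne hz) (h.axisDir_ne hkb hz) (h.axisNormal_ne hkb hz)
  · rw [real_inner_comm]; exact h.inner_axisDir_leaf hz
  · rw [real_inner_comm]; exact h.inner_axisNormal_leaf hz
  · exact h4
  · rw [real_inner_smul_left, h.inner_axisDir_leaf hz, h1, mul_zero]
  · rw [real_inner_smul_left, div_mul_cancel₀ _ hA]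
  · rw [real_inner_smul_left, h3, h4, mul_zero]

/-- By `pd_nabla`, `nabla X f` is again constant on the leaves. Differentiating its orthogonality to
`pd et X` along a leaf therefore makes it orthogonal to the acceleration as well. -/
theorem nabla_eq_smul_axisDir {f : ℝ × ℝ → E3} (hf : ContDiffOn ℝ ∞ f (I ×ˢ J))
    (h0 : ∀ z ∈ I ×ˢ J, pd et f z = 0)
    (h1 : ∀ z ∈ I ×ˢ J, ⟪nabla X f z, pd et X z⟫ = 0) (hz : z ∈ I ×ˢ J) :
    ∃ m : ℝ, nabla X f z = m • axisDir X N k z := by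
  refine h.eq_smul_axisDir hkb hz (h1 z hz) ?_
  have h2 := pd_eq_zero_of_eqOn_const (w := et) h.isOpen h1 hz
  rw [pd_inner (h.diffAt (h.smooth_nabla hf) hz) (h.diffAt (h.smooth_pd h.smooth_map et) hz),
    h.pd_nabla hf hz, h0 z hz, nabla, pd_eq_zero_of_eqOn_const h.isOpen h0 hz] at h2
  simpa using h2

include hl hne hk

omit hkb in
theorem pd_axisDir (hz : z ∈ I ×ˢ J) : pd et (axisDir X N k) z = 0 := by
  have hkd := h.diffAt h.smooth_curv hz
  have hbd := h.diffAt h.smooth_bend hz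
  have hqd := h.diffAt h.smooth_cross hz
  have hnd := h.diffAt h.smooth_normal hz
  unfold axisDir
  rw [pd_add (hkd.fun_smul hqd) (hbd.fun_smul hnd), pd_smul hkd hqd, pd_smul hbd hnd,
    hk z hz, h.pd_bend hk hl hne hz, h.pd_cross hl hne hz, h.curvature_line z hz]
  module

/-- `axisPoint` is the centre of curvature of the leaf: `axisSq` is constant on the leaf and
`axisNormal` has derivative `-axisSq • pd et X`, which cancels the motion of `X`. -/
theorem pd_axisPoint (hz : z ∈ I ×ˢ J) : pd et (axisPoint X N k) z = 0 := by
  have hkd := h.diffAt h.smooth_curv hz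
  have hbd := h.diffAt h.smooth_bend hz
  have hqd := h.diffAt h.smooth_cross hz
  have hnd := h.diffAt h.smooth_normal hz
  have hGd := h.diffAt h.smooth_crossSq hz
  have hG := h.pd_crossSq hl hne hz
  have hb := h.pd_bend hk hl hne hz
  have h1 : pd et (axisSq X k) z = 0 := by
    unfold axisSq
    rw [pd_add (by fun_prop) (by fun_prop), pd_mul (by fun_prop) hGd, pd_mul hkd hkd,
      pd_mul hbd hbd, hk z hz, hG, hb]
    simp
  have h2 : pd et (axisNormal X N k) z = -(axisSq X k z) • pd et X z := by
    unfold axisNormal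
    rw [pd_sub ((hkd.fun_mul hGd).fun_smul hnd) (hbd.fun_smul hqd), pd_smul (hkd.fun_mul hGd) hnd,
      pd_smul hbd hqd, pd_mul hkd hGd, hk z hz, hG, hb, h.pd_cross hl hne hz,
      h.curvature_line z hz, axisSq]
    module
  have hW := h.diffAt h.smooth_axisSq hz
  have hpos := (h.axisSq_pos hkb hz).ne'
  have h3 : pd et (fun z => (axisSq X k z)⁻¹) z = 0 := by
    have hc : HasFDerivAt (axisSq X k) (fderiv ℝ (axisSq X k) z) z := hW.hasFDerivAt
    have := (hasDerivAt_inv hpos).comp_hasFDerivAt z hc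
    unfold pd at h1 ⊢
    rw [show (fun z => (axisSq X k z)⁻¹) = (fun y => y⁻¹) ∘ axisSq X k from rfl, this.fderiv]
    simp [h1]
  unfold axisPoint
  rw [pd_add (h.diffAt h.smooth_map hz) ((hW.fun_inv hpos).fun_smul
    (h.diffAt h.smooth_axisNormal hz)), pd_smul (hW.fun_inv hpos)
    (h.diffAt h.smooth_axisNormal hz), h2, h3, smul_smul]
  rw [mul_neg, inv_mul_cancel₀ hpos]
  module

theorem nabla_axisDir (hz : z ∈ I ×ˢ J) :
    ∃ m : ℝ, nabla X (axisDir X N k) z = m • axisDir X N k z := by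
  refine h.nabla_eq_smul_axisDir hkb h.smooth_axisDir
    (fun z hz => h.pd_axisDir hk hl hne hz) (fun z hz => ?_) hz
  have h1 := pd_eq_zero_of_eqOn_const (w := (1, -shift X z)) h.isOpen
    (fun z hz => h.inner_axisDir_leaf hz) hz
  have h2 := h.nabla_leaf_eq hl hne hz
  unfold nabla at h2
  rwa [pd_inner (h.diffAt h.smooth_axisDir hz) (h.diffAt (h.smooth_pd h.smooth_map et) hz), h2,
    real_inner_smul_right, h.inner_axisDir_leaf hz, mul_zero, add_zero] at h1

theorem nabla_axisPoint (hz : z ∈ I ×ˢ J) :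
    ∃ m : ℝ, nabla X (axisPoint X N k) z = m • axisDir X N k z := by
  refine h.nabla_eq_smul_axisDir hkb (h.smooth_axisPoint hkb)
    (fun z hz => h.pd_axisPoint hk hl hne hkb hz) (fun z hz => ?_) hz
  have h1 := pd_eq_zero_of_eqOn_const (w := (1, -shift X z)) h.isOpen
    (fun z hz => h.inner_sub_axisPoint hz) hz
  have h2 := h.nabla_leaf_eq hl hne hz
  have hX := h.diffAt h.smooth_map hz
  have hC := h.diffAt (h.smooth_axisPoint hkb) hz
  have h3 := h.inner_leaf_cross hz
  rw [real_inner_comm] at h3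
  unfold nabla at h2
  unfold cross nabla at h3
  rw [pd_inner (hX.fun_sub hC) (h.diffAt (h.smooth_pd h.smooth_map et) hz), h2,
    real_inner_smul_right, h.inner_sub_axisPoint hz, mul_zero, add_zero,
    pd_sub hX hC, inner_sub_left, h3] at h1
  rw [nabla]
  linarith

/-- The axis does not depend on the parameters. -/
theorem axis_eq (hz : z ∈ I ×ˢ J) (hy : y ∈ I ×ˢ J) :
    (∃ m : ℝ, axisDir X N k z = m • axisDir X N k y) ∧
      ∃ m : ℝ, axisPoint X N k y - axisPoint X N k z = m • axisDir X N k z := by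
  -- Project along the axis direction at `z`. The projected `axisDir` satisfies a linear inequality
  -- and vanishes at `z`, hence everywhere; then the projected `axisPoint` has derivative zero.
  have hp : ∀ w : E3, (ℝ ∙ axisDir X N k z)ᗮ.starProjection w = 0 ↔
      ∃ m : ℝ, w = m • axisDir X N k z := by
    intro w
    rw [Submodule.starProjection_apply_eq_zero_iff, Submodule.orthogonal_orthogonal,
      Submodule.mem_span_singleton]
    exact exists_congr fun m => eq_comm
  set P := (ℝ ∙ axisDir X N k z)ᗮ.starProjection
  have hA : ∀ y ∈ I ×ˢ J, P (axisDir X N k y) = 0 := by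
    intro y hy
    have hne' : ∀ z ∈ I ×ˢ J, ⟪axisDir X N k z, axisDir X N k z⟫ ≠ 0 := fun z hz =>
      (real_inner_self_pos.2 (h.axisDir_ne hkb hz)).ne'
    refine h.eq_zero_of_norm_nabla_le (f := fun y => P (axisDir X N k y))
      (c := fun z => ‖⟪nabla X (axisDir X N k) z, axisDir X N k z⟫ /
        ⟪axisDir X N k z, axisDir X N k z⟫‖)
      (P.contDiff.comp_contDiffOn h.smooth_axisDir) (fun y hy => ?_) ?_ (fun y hy => ?_) hz
      ((hp _).2 ⟨1, by simp⟩) hy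
    · rw [pd_clm_comp P (h.diffAt h.smooth_axisDir hy), h.pd_axisDir hk hl hne hy, map_zero]
    · exact (((h.smooth_nabla h.smooth_axisDir).inner ℝ h.smooth_axisDir).div
        (h.smooth_axisDir.inner ℝ h.smooth_axisDir) hne').continuousOn.norm
    · obtain ⟨m, hm⟩ := h.nabla_axisDir hk hl hne hkb hy
      have : nabla X (fun y => P (axisDir X N k y)) y = P (nabla X (axisDir X N k) y) :=
        pd_clm_comp P (h.diffAt h.smooth_axisDir hy)
      rw [this, hm, map_smul, norm_smul, real_inner_smul_left,
        mul_div_cancel_right₀ _ (hne' y hy)]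
  constructor
  · obtain ⟨m, hm⟩ := (hp _).1 (hA y hy)
    have hm0 : m ≠ 0 := by
      rintro rfl
      exact h.axisDir_ne hkb hy (by rw [hm, zero_smul])
    exact ⟨m⁻¹, by rw [hm, smul_smul, inv_mul_cancel₀ hm0, one_smul]⟩
  · rw [← hp]
    have hCs := h.smooth_axisPoint hkb
    have hpd : ∀ y ∈ I ×ˢ J, ∀ w, pd w (fun y => P (axisPoint X N k y - axisPoint X N k z)) y
        = P (pd w (axisPoint X N k) y) := fun y hy w => by
      rw [pd_clm_comp P ((h.diffAt hCs hy).sub_const _)]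
      rw [pd_sub_const]
    refine h.eq_zero_of_norm_nabla_le
      (f := fun y => P (axisPoint X N k y - axisPoint X N k z)) (c := fun _ => 0)
      (P.contDiff.comp_contDiffOn (hCs.sub contDiffOn_const)) (fun y hy => ?_)
      continuousOn_const (fun y hy => ?_) hz (by simp) hy
    · rw [hpd y hy, h.pd_axisPoint hk hl hne hkb hy, map_zero]
    · obtain ⟨m, hm⟩ := h.nabla_axisPoint hk hl hne hkb hy
      have : nabla X (fun y => P (axisPoint X N k y - axisPoint X N k z)) y
          = P (nabla X (axisPoint X N k) y) := hpd y hy _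
      rw [this, hm, map_smul, hA y hy]
      simp

theorem inner_axisDir_leaf_eq_zero (hz : z ∈ I ×ˢ J) (hy : y ∈ I ×ˢ J) :
    ⟪axisDir X N k z, pd et X y⟫ = 0 := by
  obtain ⟨m, hm⟩ := (h.axis_eq hk hl hne hkb hz hy).1
  rw [hm, real_inner_smul_left, h.inner_axisDir_leaf hy, mul_zero]

theorem inner_sub_axisPoint_leaf (hz : z ∈ I ×ˢ J) (hy : y ∈ I ×ˢ J) :
    ⟪X y - axisPoint X N k z, pd et X y⟫ = 0 := by
  obtain ⟨m, hm⟩ := (h.axis_eq hk hl hne hkb hz hy).2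
  rw [← sub_add_sub_cancel _ (axisPoint X N k y), inner_add_left, h.inner_sub_axisPoint hy, hm,
    real_inner_smul_left, h.inner_axisDir_leaf_eq_zero hk hl hne hkb hz hy, mul_zero, add_zero]

/-- A line that is an axis of the `t`-curves near one point is an axis of all `t`-curves. -/
theorem isAxis_of_eventually {o τ : E3} (hz : z ∈ I ×ˢ J)
    (h0 : ∀ᶠ y in nhds z, ⟪τ, pd et X y⟫ = 0 ∧ ⟪X y - o, pd et X y⟫ = 0) (hy : y ∈ I ×ˢ J) :
    ⟪τ, pd et X y⟫ = 0 ∧ ⟪X y - o, pd et X y⟫ = 0 := by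
  have hX := h.diffAt h.smooth_map hz
  have hp := h.diffAt (h.smooth_pd h.smooth_map et) hz
  have key : ∀ v : E3, (∀ᶠ y in nhds z, ⟪v, pd et X y⟫ = 0) → ⟪v, pd et X y⟫ = 0 := by
    intro v hv
    -- Orthogonality on a whole neighbourhood can be differentiated along the leaf, which makes `v`
    -- parallel to the axis at `z`; orthogonality at the point alone would not suffice.
    have h1 : ⟪v, pd et (pd et X) z⟫ = 0 := by
      have h2 : (fun y => ⟪v, pd et X y⟫) =ᶠ[nhds z] fun _ => 0 := hv
      have h3 : pd et (fun y => ⟪v, pd et X y⟫) z = 0 := by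
        change fderiv ℝ (fun y => ⟪v, pd et X y⟫) z et = 0
        rw [h2.fderiv_eq]; simp
      rw [pd_inner (differentiableAt_const _) hp] at h3
      simpa [pd] using h3
    obtain ⟨m, hm⟩ := h.eq_smul_axisDir hkb hz hv.self_of_nhds h1
    rw [hm, real_inner_smul_left, h.inner_axisDir_leaf_eq_zero hk hl hne hkb hz hy, mul_zero]
  refine ⟨key τ (h0.mono fun _ => And.left), ?_⟩
  have h1 := key (axisPoint X N k z - o) (by
    filter_upwards [h0, h.isOpen.mem_nhds hz] with y hy hyB
    have := h.inner_sub_axisPoint_leaf hk hl hne hkb hz hyB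
    rw [← sub_sub_sub_cancel_left _ _ (X y), inner_sub_left, hy.2, this, sub_zero])
  rw [← sub_add_sub_cancel _ (axisPoint X N k z), inner_add_left, h1,
    h.inner_sub_axisPoint_leaf hk hl hne hkb hz hy, add_zero]

end Axis

end IsPatch

/-- Polar coordinates for a smooth map into the punctured plane. -/
theorem exists_polar {E : Type*} [NormedAddCommGroup E] [NormedSpace ℝ E] {B : Set E}
    (hB : IsOpen B) {a₀ a₁ : E → ℝ} (h₀ : ContDiffOn ℝ ∞ a₀ B) (h₁ : ContDiffOn ℝ ∞ a₁ B)
    {z₀ : E} (hz₀ : z₀ ∈ B) (hne : a₀ z₀ ^ 2 + a₁ z₀ ^ 2 ≠ 0) :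
    ∃ (W : Set E) (θ : E → ℝ), IsOpen W ∧ z₀ ∈ W ∧ W ⊆ B ∧ ContDiffOn ℝ ∞ θ W ∧
      ∀ z ∈ W, a₀ z = √(a₀ z ^ 2 + a₁ z ^ 2) * Real.cos (θ z) ∧
        a₁ z = √(a₀ z ^ 2 + a₁ z ^ 2) * Real.sin (θ z) := by
  set w : ℂ := ⟨a₀ z₀, a₁ z₀⟩
  set φ := Complex.arg w
  have hw0 : ‖w‖ * Real.cos φ = a₀ z₀ := Complex.norm_mul_cos_arg w
  have hw1 : ‖w‖ * Real.sin φ = a₁ z₀ := Complex.norm_mul_sin_arg w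
  have hcs := Real.sin_sq_add_cos_sq φ
  have hw : ‖w‖ ≠ 0 := by
    intro h; rw [h] at hw0 hw1; apply hne; rw [← hw0, ← hw1]; ring
  have hwpos : 0 < ‖w‖ := lt_of_le_of_ne (norm_nonneg _) hw.symm
  -- After rotation by the argument at `z₀` the first coordinate is positive near `z₀`, so `arctan
  -- (d / c)` is a smooth choice of angle.
  set c : E → ℝ := fun z => a₀ z * Real.cos φ + a₁ z * Real.sin φ with hc
  set d : E → ℝ := fun z => a₁ z * Real.cos φ - a₀ z * Real.sin φ with hd
  have hcsm : ContDiffOn ℝ ∞ c B := (h₀.mul contDiffOn_const).add (h₁.mul contDiffOn_const)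
  have hdsm : ContDiffOn ℝ ∞ d B := (h₁.mul contDiffOn_const).sub (h₀.mul contDiffOn_const)
  have hWsub : B ∩ c ⁻¹' Set.Ioi 0 ⊆ B := Set.inter_subset_left
  have hcd : ∀ z, c z ^ 2 + d z ^ 2 = a₀ z ^ 2 + a₁ z ^ 2 := by
    intro z; simp only [hc, hd]; linear_combination (a₀ z ^ 2 + a₁ z ^ 2) * hcs
  refine ⟨B ∩ c ⁻¹' Set.Ioi 0, fun z => φ + Real.arctan (d z / c z),
    hcsm.continuousOn.isOpen_inter_preimage hB isOpen_Ioi, ⟨hz₀, ?_⟩, hWsub,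
    contDiffOn_const.add (Real.contDiff_arctan.comp_contDiffOn
      ((hdsm.mono hWsub).div (hcsm.mono hWsub) fun z hz => (ne_of_gt hz.2))), fun z hz => ?_⟩
  · simp only [Set.mem_preimage, Set.mem_Ioi, hc]
    rw [← hw0, ← hw1]
    have : ‖w‖ * Real.cos φ * Real.cos φ + ‖w‖ * Real.sin φ * Real.sin φ = ‖w‖ := by
      linear_combination ‖w‖ * hcs
    rwa [this]
  · have hcz : 0 < c z := hz.2
    have hR : √(1 + (d z / c z) ^ 2) = √(a₀ z ^ 2 + a₁ z ^ 2) / c z := by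
      rw [← hcd, ← Real.sqrt_sq hcz.le, ← Real.sqrt_div' _ (sq_nonneg _), Real.sqrt_sq hcz.le]
      congr 1
      field_simp
    have hRpos : 0 < √(a₀ z ^ 2 + a₁ z ^ 2) := by
      rw [← hcd]; apply Real.sqrt_pos.2; positivity
    simp only
    rw [Real.cos_add, Real.sin_add, Real.cos_arctan, Real.sin_arctan, hR]
    set R := √(a₀ z ^ 2 + a₁ z ^ 2)
    have e1 : R * (Real.cos φ * (1 / (R / c z)) - Real.sin φ * (d z / c z / (R / c z)))
        = Real.cos φ * c z - Real.sin φ * d z := by field_simp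
    have e2 : R * (Real.sin φ * (1 / (R / c z)) + Real.cos φ * (d z / c z / (R / c z)))
        = Real.sin φ * c z + Real.cos φ * d z := by field_simp
    rw [e1, e2]
    simp only [hc, hd]
    constructor
    · linear_combination (-a₀ z) * hcs
    · linear_combination (-a₁ z) * hcs

theorem contDiffOn_slice {I J : Set ℝ} {f : ℝ × ℝ → ℝ} (hf : ContDiffOn ℝ ∞ f (I ×ˢ J)) {t : ℝ}
    (ht : t ∈ J) : ContDiffOn ℝ ∞ (fun s => f (s, t)) I :=
  hf.comp (by fun_prop) fun _ hs => ⟨hs, ht⟩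

namespace IsPatch

/-! ### Constancy of the leaf curvature along circles and lines -/

section Circles

variable {I J : Set ℝ} {X N : ℝ × ℝ → E3} {k : ℝ × ℝ → ℝ} (h : IsPatch I J X N k)

include h

/-- Joachimsthal's argument: `⟪N, X - c⟫` is constant on the leaf, since `N` moves in the direction
of `pd et X`, which is orthogonal to `X - c`. As `N` lies in the span of `X - c` and `τ`, the normal
part of the leaf's acceleration gives `k = -⟪N, X - c⟫ / r ^ 2`. -/
theorem curv_eq_of_circle {s r : ℝ} {c τ : E3} (hs : s ∈ I) (hτ : ‖τ‖ = 1) (hr : 0 < r)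
    (hc : ∀ t ∈ J, ‖X (s, t) - c‖ = r ∧ ⟪X (s, t) - c, τ⟫ = 0) {t t' : ℝ}
    (ht : t ∈ J) (ht' : t' ∈ J) : k (s, t) = k (s, t') := by
  have hYs : ContDiffOn ℝ ∞ (fun z => X z - c) (I ×ˢ J) := h.smooth_map.sub contDiffOn_const
  have hps := h.smooth_pd h.smooth_map et
  have hτs : ContDiffOn ℝ ∞ (fun _ : ℝ × ℝ => τ) (I ×ˢ J) := contDiffOn_const
  have h1 : ∀ t ∈ J, ⟪pd et X (s, t), X (s, t) - c⟫ = 0 := by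
    intro t ht
    have hz : (s, t) ∈ I ×ˢ J := ⟨hs, ht⟩
    have := h.pd_eq_zero_of_slice (hYs.inner ℝ hYs) hs (c := r ^ 2)
      (fun t ht => by rw [real_inner_self_eq_norm_sq, (hc t ht).1]) t ht
    rw [pd_inner (h.diffAt hYs hz) (h.diffAt hYs hz), pd_sub_const,
      real_inner_comm (pd et X (s, t))] at this
    linarith
  have h2 : ∀ t ∈ J, ⟪pd et X (s, t), τ⟫ = 0 := by
    intro t ht
    have hz : (s, t) ∈ I ×ˢ J := ⟨hs, ht⟩
    have := h.pd_eq_zero_of_slice (hYs.inner ℝ hτs) hs (fun t ht => (hc t ht).2) t ht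
    rw [pd_inner (h.diffAt hYs hz) (h.diffAt hτs hz), pd_sub_const] at this
    simpa [pd] using this
  have h3 : ∀ t ∈ J, ⟪pd et (pd et X) (s, t), X (s, t) - c⟫ = -leafSq X (s, t) := by
    intro t ht
    have hz : (s, t) ∈ I ×ˢ J := ⟨hs, ht⟩
    have := h.pd_eq_zero_of_slice (hps.inner ℝ hYs) hs h1 t ht
    rw [pd_inner (h.diffAt hps hz) (h.diffAt hYs hz), pd_sub_const, ← leafSq] at this
    linarith
  have h4 : ∀ t ∈ J, ⟪pd et (pd et X) (s, t), τ⟫ = 0 := by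
    intro t ht
    have hz : (s, t) ∈ I ×ˢ J := ⟨hs, ht⟩
    have := h.pd_eq_zero_of_slice (hps.inner ℝ hτs) hs h2 t ht
    rw [pd_inner (h.diffAt hps hz) (h.diffAt hτs hz)] at this
    simpa [pd] using this
  have h5 : ∀ t ∈ J, pd et (fun z => ⟪N z, X z - c⟫) (s, t) = 0 := by
    intro t ht
    have hz : (s, t) ∈ I ×ˢ J := ⟨hs, ht⟩
    rw [pd_inner (h.diffAt h.smooth_normal hz) (h.diffAt hYs hz), pd_sub_const,
      h.curvature_line _ hz, inner_neg_left, real_inner_smul_left, h1 t ht, h.normal _ hz]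
    simp
  have h6 : ⟪N (s, t), X (s, t) - c⟫ = ⟪N (s, t'), X (s, t') - c⟫ :=
    h.eq_of_pd_eq_zero_slice (h.smooth_normal.inner ℝ hYs) hs h5 ht ht'
  have h7 : ∀ t ∈ J, k (s, t) = -(⟪N (s, t), X (s, t) - c⟫ / r ^ 2) := by
    intro t ht
    have hz : (s, t) ∈ I ×ˢ J := ⟨hs, ht⟩
    have hr2 : ⟪X (s, t) - c, X (s, t) - c⟫ = r ^ 2 := by
      rw [real_inner_self_eq_norm_sq, (hc t ht).1]
    have hττ : ⟪τ, τ⟫ = 1 := by rw [real_inner_self_eq_norm_sq, hτ]; norm_num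
    have hN : N (s, t) = (⟪N (s, t), X (s, t) - c⟫ / r ^ 2) • (X (s, t) - c)
        + ⟪N (s, t), τ⟫ • τ := by
      apply eq_of_inner_eq (h.leaf_ne hz) (b := X (s, t) - c) (c := τ)
      · intro h0; rw [h0] at hr2; rw [inner_zero_left] at hr2; exact (pow_pos hr 2).ne hr2
      · intro h0; rw [h0] at hτ; simp at hτ
      · exact h1 t ht
      · exact h2 t ht
      · exact (hc t ht).2
      · rw [real_inner_comm, h.inner_leaf_normal hz, inner_add_left, real_inner_smul_left,
          real_inner_smul_left, real_inner_comm (pd et X (s, t)), real_inner_comm (pd et X (s, t)),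
          h1 t ht, h2 t ht]
        simp
      · rw [inner_add_left, real_inner_smul_left, real_inner_smul_left, hr2,
          real_inner_comm (X (s, t) - c) τ, (hc t ht).2]
        field_simp
        ring
      · rw [inner_add_left, real_inner_smul_left, real_inner_smul_left, hττ, (hc t ht).2]
        ring
    have h8 := h.inner_pd_leaf_normal hz
    rw [hN, inner_add_right, real_inner_smul_right, real_inner_smul_right, h3 t ht, h4 t ht] at h8
    apply mul_right_cancel₀ (h.leafSq_pos hz).ne'
    linarith
  rw [h7 t ht, h7 t' ht', h6]

/-- Velocity and acceleration of the leaf are both parallel to the line, so the normal part `k *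
leafSq` of the acceleration vanishes. -/
theorem curv_eq_zero_of_line {s : ℝ} {c τ : E3} (hs : s ∈ I)
    (hc : ∀ t ∈ J, ∃ m : ℝ, X (s, t) = c + m • τ) {t : ℝ} (ht : t ∈ J) : k (s, t) = 0 := by
  have hp : ∀ w : E3, (ℝ ∙ τ)ᗮ.starProjection w = 0 ↔ ∃ m : ℝ, w = m • τ := by
    intro w
    rw [Submodule.starProjection_apply_eq_zero_iff, Submodule.orthogonal_orthogonal,
      Submodule.mem_span_singleton]
    exact exists_congr fun m => eq_comm
  set P := (ℝ ∙ τ)ᗮ.starProjection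
  have hz : (s, t) ∈ I ×ˢ J := ⟨hs, ht⟩
  have hps := h.smooth_pd h.smooth_map et
  have h1 : ∀ t ∈ J, P (pd et X (s, t)) = 0 := by
    intro t ht
    have hz : (s, t) ∈ I ×ˢ J := ⟨hs, ht⟩
    rw [← pd_clm_comp P (h.diffAt h.smooth_map hz)]
    refine h.pd_eq_zero_of_slice (P.contDiff.comp_contDiffOn h.smooth_map) hs (c := P c)
      (fun t ht => ?_) t ht
    obtain ⟨m, hm⟩ := hc t ht
    rw [Function.comp_apply, hm, map_add, (hp _).2 ⟨m, rfl⟩, add_zero]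
  have h2 : P (pd et (pd et X) (s, t)) = 0 := by
    rw [← pd_clm_comp P (h.diffAt hps hz)]
    exact h.pd_eq_zero_of_slice (P.contDiff.comp_contDiffOn hps) hs h1 t ht
  obtain ⟨m, hm⟩ := (hp _).1 (h1 t ht)
  obtain ⟨m', hm'⟩ := (hp _).1 h2
  have hm0 : m ≠ 0 := by
    rintro rfl
    exact h.leaf_ne hz (by rw [hm, zero_smul])
  have h3 := h.inner_leaf_normal hz
  rw [hm, real_inner_smul_left] at h3
  have h4 := h.inner_pd_leaf_normal hz
  rw [hm', real_inner_smul_left, (mul_eq_zero.1 h3).resolve_left hm0, mul_zero] at h4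
  exact (mul_eq_zero.1 h4.symm).resolve_right (h.leafSq_pos hz).ne'

/-- The principal curvature along circular curvature lines is constant. -/
theorem pd_curv_of_liesOnCircleOrLine
    (hC : ∀ s, LiesOnCircleOrLine (X '' {z | z ∈ I ×ˢ J ∧ z.1 = s})) {z : ℝ × ℝ}
    (hz : z ∈ I ×ˢ J) : pd et k z = 0 := by
  refine h.pd_eq_zero_of_eq h.smooth_curv (fun s t t' hz hz' => ?_) hz
  have hm : ∀ t ∈ J, X (s, t) ∈ X '' {z | z ∈ I ×ˢ J ∧ z.1 = s} := fun t ht =>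
    ⟨(s, t), ⟨⟨hz.1, ht⟩, rfl⟩, rfl⟩
  rcases hC s with ⟨c, τ, r, hτ, hr, hc⟩ | ⟨c, τ, -, hc⟩
  · exact h.curv_eq_of_circle hz.1 hτ hr (fun t ht => hc _ (hm t ht)) hz.2 hz'.2
  · rw [h.curv_eq_zero_of_line hz.1 (fun t ht => hc _ (hm t ht)) hz.2,
      h.curv_eq_zero_of_line hz.1 (fun t ht => hc _ (hm t ht)) hz'.2]

end Circles

/-! ### Rotational parametrization of the parallel surfaces -/

section Rotation

variable {I J : Set ℝ} {X N : ℝ × ℝ → E3} {k : ℝ × ℝ → ℝ} (h : IsPatch I J X N k)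

include h

/-- If the `t`-curves are circles about a common axis, the parallel surfaces of `X` are surfaces of
revolution. -/
theorem exists_revolution {o : E3} (F : OrthonormalBasis (Fin 3) ℝ E3)
    (hax : ∀ z ∈ I ×ˢ J, ⟪F 2, pd et X z⟫ = 0 ∧ ⟪X z - o, pd et X z⟫ = 0) (d : ℝ)
    {z₀ : ℝ × ℝ} (hz₀ : z₀ ∈ I ×ˢ J) :
    ∃ (W : Set (ℝ × ℝ)) (θ : ℝ × ℝ → ℝ) (r η : ℝ → ℝ), IsOpen W ∧ z₀ ∈ W ∧ W ⊆ I ×ˢ J ∧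
      ContDiffOn ℝ ∞ θ W ∧ ContDiffOn ℝ ∞ r I ∧ ContDiffOn ℝ ∞ η I ∧
      (∀ z ∈ W, ∀ w : ℝ × ℝ, w.1 = 0 → pd w θ z = 0 → w = 0) ∧
      ∀ z ∈ W, X z + d • N z = o + (r z.1 * Real.cos (θ z)) • F 0
        + (r z.1 * Real.sin (θ z)) • F 1 + η z.1 • F 2 := by
  have hF : ∀ i j, ⟪F i, F j⟫ = if i = j then 1 else 0 := orthonormal_iff_ite.1 F.orthonormal
  have hF0 := F.orthonormal.ne_zero
  have hexp : ∀ v : E3, v = ⟪v, F 0⟫ • F 0 + ⟪v, F 1⟫ • F 1 + ⟪v, F 2⟫ • F 2 := by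
    intro v
    conv_lhs => rw [← F.sum_repr' v]
    simp only [Fin.sum_univ_three, real_inner_comm]
  have hYs : ContDiffOn ℝ ∞ (fun z => X z - o) (I ×ˢ J) := h.smooth_map.sub contDiffOn_const
  have hFs : ∀ i, ContDiffOn ℝ ∞ (fun _ : ℝ × ℝ => F i) (I ×ˢ J) := fun i => contDiffOn_const
  set a : Fin 3 → ℝ × ℝ → ℝ := fun i z => ⟪X z - o, F i⟫ with ha
  have has : ∀ i, ContDiffOn ℝ ∞ (a i) (I ×ˢ J) := fun i => hYs.inner ℝ (hFs i)
  have hapd : ∀ i, ∀ z ∈ I ×ˢ J, pd et (a i) z = ⟪pd et X z, F i⟫ := by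
    intro i z hz
    simp only [ha]
    rw [pd_inner (h.diffAt hYs hz) (h.diffAt (hFs i) hz), pd_sub_const]
    simp [pd]
  have hpF2 : ∀ z ∈ I ×ˢ J, ⟪pd et X z, F 2⟫ = 0 := fun z hz => by
    rw [real_inner_comm]; exact (hax z hz).1
  have hpY : ∀ z ∈ I ×ˢ J, ⟪pd et X z, X z - o⟫ = 0 := fun z hz => by
    rw [real_inner_comm]; exact (hax z hz).2
  set Q : ℝ × ℝ → ℝ := fun z => a 0 z ^ 2 + a 1 z ^ 2 with hQ
  have hY : ∀ z, X z - o = a 0 z • F 0 + a 1 z • F 1 + a 2 z • F 2 := fun z => hexp _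
  have hQpd : ∀ z ∈ I ×ˢ J, pd et Q z = 0 := by
    intro z hz
    have d0 := h.diffAt (has 0) hz
    have d1 := h.diffAt (has 1) hz
    have e : Q = fun z => a 0 z * a 0 z + a 1 z * a 1 z := by ext z; simp only [hQ]; ring
    have h1 := hpY z hz
    rw [hY z, inner_add_right, inner_add_right, real_inner_smul_right, real_inner_smul_right,
      real_inner_smul_right, hpF2 z hz] at h1
    rw [e, pd_add (d0.fun_mul d0) (d1.fun_mul d1), pd_mul d0 d0, pd_mul d1 d1, hapd 0 z hz,
      hapd 1 z hz]
    linarith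
  -- A leaf cannot meet the axis: at such a point `X - o` would be a multiple of `F 2`, and
  -- differentiating `⟪pd et X, X - o⟫ = 0` along the leaf would give `leafSq = 0`.
  have hQne : ∀ z ∈ I ×ˢ J, Q z ≠ 0 := by
    intro z hz h0
    have e0 : a 0 z = 0 := by simp only [hQ] at h0; nlinarith [sq_nonneg (a 0 z), sq_nonneg (a 1 z)]
    have e1 : a 1 z = 0 := by simp only [hQ] at h0; nlinarith [sq_nonneg (a 0 z), sq_nonneg (a 1 z)]
    have hps := h.diffAt (h.smooth_pd h.smooth_map et) hz
    have h1 := pd_eq_zero_of_eqOn_const (w := et) h.isOpen hpY hz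
    rw [pd_inner hps (h.diffAt hYs hz), pd_sub_const, hY z, e0, e1, ← leafSq] at h1
    have h2 := pd_eq_zero_of_eqOn_const (w := et) h.isOpen hpF2 hz
    rw [pd_inner hps (h.diffAt (hFs 2) hz)] at h2
    have h3 : ⟪pd et (pd et X) z, F 2⟫ = 0 := by simpa [pd] using h2
    simp only [zero_smul, zero_add, real_inner_smul_right, h3, mul_zero] at h1
    exact (h.leafSq_pos hz).ne' h1
  have hQs : ContDiffOn ℝ ∞ Q (I ×ˢ J) := ((has 0).pow 2).add ((has 1).pow 2)
  have hQpos : ∀ z ∈ I ×ˢ J, 0 < Q z := fun z hz =>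
    lt_of_le_of_ne (add_nonneg (sq_nonneg _) (sq_nonneg _)) (hQne z hz).symm
  set R : ℝ × ℝ → ℝ := fun z => √(Q z) with hR
  have hRs : ContDiffOn ℝ ∞ R (I ×ˢ J) := hQs.sqrt hQne
  have hRpd : ∀ z ∈ I ×ˢ J, pd et R z = 0 := fun z hz => by
    refine h.pd_eq_zero_of_eq hRs (fun s t t' hz hz' => ?_) hz
    simp only [hR]; rw [h.eq_of_pd_eq_zero hQs hQpd hz hz']
  set ν : ℝ × ℝ → ℝ := fun z => ⟪N z, F 2⟫ with hν
  have hνs : ContDiffOn ℝ ∞ ν (I ×ˢ J) := h.smooth_normal.inner ℝ (hFs 2)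
  have hνpd : ∀ z ∈ I ×ˢ J, pd et ν z = 0 := by
    intro z hz
    simp only [hν]
    rw [pd_inner (h.diffAt h.smooth_normal hz) (h.diffAt (hFs 2) hz), h.curvature_line z hz,
      inner_neg_left, real_inner_smul_left, hpF2 z hz]
    simp [pd]
  set μ : ℝ × ℝ → ℝ := fun z => ⟪N z, X z - o⟫ with hμ
  have hμs : ContDiffOn ℝ ∞ μ (I ×ˢ J) := h.smooth_normal.inner ℝ hYs
  have hμpd : ∀ z ∈ I ×ˢ J, pd et μ z = 0 := by
    intro z hz
    simp only [hμ]
    rw [pd_inner (h.diffAt h.smooth_normal hz) (h.diffAt hYs hz), h.curvature_line z hz,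
      inner_neg_left, real_inner_smul_left, hpY z hz, pd_sub_const, h.normal z hz]
    simp
  have ha2pd : ∀ z ∈ I ×ˢ J, pd et (a 2) z = 0 := fun z hz => by rw [hapd 2 z hz, hpF2 z hz]
  -- `N` is orthogonal to the leaf, hence a combination of the radial vector and `F 2`. Both
  -- coefficients are constant on the leaves, being expressed by `μ`, `ν`, `a 2` and `Q`.
  set α : ℝ × ℝ → ℝ := fun z => (μ z - a 2 z * ν z) / Q z with hα
  have hαs : ContDiffOn ℝ ∞ α (I ×ˢ J) := (hμs.sub ((has 2).mul hνs)).div hQs hQne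
  have hN : ∀ z ∈ I ×ˢ J, N z = α z • (a 0 z • F 0 + a 1 z • F 1) + ν z • F 2 := by
    intro z hz
    have hYF : a 0 z • F 0 + a 1 z • F 1 = (X z - o) - a 2 z • F 2 := by rw [hY z]; abel
    have hQ' : ⟪a 0 z • F 0 + a 1 z • F 1, a 0 z • F 0 + a 1 z • F 1⟫ = Q z := by
      simp [inner_add_left, inner_add_right, real_inner_smul_left, real_inner_smul_right, hF, hQ,
        -inner_self_eq_norm_sq_to_K]
      ring
    have hp0 : ⟪pd et X z, a 0 z • F 0 + a 1 z • F 1⟫ = 0 := by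
      rw [hYF, inner_sub_right, real_inner_smul_right, hpY z hz, hpF2 z hz]; simp
    have h02 : ⟪a 0 z • F 0 + a 1 z • F 1, F 2⟫ = 0 := by
      simp [inner_add_left, real_inner_smul_left, hF]
    refine eq_of_inner_eq (h.leaf_ne hz) (b := a 0 z • F 0 + a 1 z • F 1) (c := F 2)
      (fun h0 => ?_) (hF0 2) hp0 (hpF2 z hz) h02 ?_ ?_ ?_
    · rw [h0, inner_zero_left] at hQ'; exact hQne z hz hQ'.symm
    · rw [h.normal z hz, inner_add_left, real_inner_smul_left, real_inner_smul_left,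
        real_inner_comm (pd et X z), real_inner_comm (pd et X z), hp0, hpF2 z hz]
      simp
    · rw [inner_add_left, real_inner_smul_left, real_inner_smul_left, hQ',
        real_inner_comm _ (F 2), h02, hα]
      simp only
      rw [div_mul_cancel₀ _ (hQne z hz), hYF, inner_sub_right, real_inner_smul_right]
      simp [hμ, hν]
    · rw [inner_add_left, real_inner_smul_left, real_inner_smul_left, h02, hF]
      simp [hν]
  obtain ⟨W, θ, hWo, hzW, hWB, hθ, hpol⟩ :=
    exists_polar h.isOpen (has 0) (has 1) hz₀ (hQne z₀ hz₀)
  have ht₀ : z₀.2 ∈ J := hz₀.2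
  -- Passing to `X + d • N` multiplies the radial part by `1 + d * α` and adds `d * ν` to the
  -- height. All functions involved are constant on the leaves, so the profile can be read off at `t
  -- = z₀.2`.
  refine ⟨W, θ, fun s => R (s, z₀.2) * (1 + d * α (s, z₀.2)),
    fun s => a 2 (s, z₀.2) + d * ν (s, z₀.2), hWo, hzW, hWB, hθ,
    contDiffOn_slice (hRs.mul (contDiffOn_const.add (contDiffOn_const.mul hαs))) ht₀,
    contDiffOn_slice ((has 2).add (contDiffOn_const.mul hνs)) ht₀, ?_, ?_⟩
  · intro z hz w hw1 hwθ
    have hzB := hWB hz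
    by_contra hw
    have hw2 : w.2 ≠ 0 := fun h2 => hw (Prod.ext hw1 h2)
    have hθ0 : pd et θ z = 0 := by
      rw [pd_eq, hw1] at hwθ
      simpa [hw2] using hwθ
    have hθd : DifferentiableAt ℝ θ z := differentiableAt_of_contDiffOn hWo hθ hz
    have hRd := h.diffAt hRs hzB
    have hcos : pd et (fun z => Real.cos (θ z)) z = 0 := by
      unfold pd at hθ0 ⊢
      rw [fderiv_cos hθd]
      simp [hθ0]
    have hsin : pd et (fun z => Real.sin (θ z)) z = 0 := by
      unfold pd at hθ0 ⊢
      rw [fderiv_sin hθd]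
      simp [hθ0]
    have e0 : pd et (a 0) z = 0 := by
      rw [pd_congr hWo (fun y hy => (hpol y hy).1) hz]
      change pd et (fun z => R z * Real.cos (θ z)) z = 0
      rw [pd_mul hRd hθd.cos, hcos, hRpd z hzB]; simp
    have e1 : pd et (a 1) z = 0 := by
      rw [pd_congr hWo (fun y hy => (hpol y hy).2) hz]
      change pd et (fun z => R z * Real.sin (θ z)) z = 0
      rw [pd_mul hRd hθd.sin, hsin, hRpd z hzB]; simp
    apply h.leaf_ne hzB
    rw [hexp (pd et X z), ← hapd 0 z hzB, ← hapd 1 z hzB, e0, e1, hpF2 z hzB]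
    simp
  · intro z hz
    have hzB := hWB hz
    have hz' : (z.1, z₀.2) ∈ I ×ˢ J := ⟨hzB.1, ht₀⟩
    have hsl : ∀ f : ℝ × ℝ → ℝ, ContDiffOn ℝ ∞ f (I ×ˢ J) → (∀ z ∈ I ×ˢ J, pd et f z = 0) →
      f (z.1, z₀.2) = f z := fun f hf hf0 => h.eq_of_pd_eq_zero hf hf0 hz' hzB
    have eQ := hsl Q hQs hQpd
    have eR := hsl R hRs hRpd
    have ea := hsl (a 2) (has 2) ha2pd
    have eν := hsl ν hνs hνpd
    have eμ := hsl μ hμs hμpd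
    have eα : α (z.1, z₀.2) = α z := by simp only [hα]; rw [eμ, ea, eν, eQ]
    have p0 : a 0 z = R z * Real.cos (θ z) := (hpol z hz).1
    have p1 : a 1 z = R z * Real.sin (θ z) := (hpol z hz).2
    have hX : X z = o + (X z - o) := by abel
    simp only
    rw [eR, eα, ea, eν, hN z hzB, hX, hY z, p0, p1]
    module

end Rotation

end IsPatch

/-- A submersion of the plane is locally the first coordinate of a diffeomorphism. -/
theorem exists_straightening {O : Set E2} (hO : IsOpen O) {g : E2 → ℝ}
    (hg : ContDiffOn ℝ ∞ g O) {z₀ : E2} (hz₀ : z₀ ∈ O) (hne : fderiv ℝ g z₀ ≠ 0) :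
    ∃ h : OpenPartialHomeomorph E2 (ℝ × ℝ), z₀ ∈ h.source ∧ h.source ⊆ O ∧
      ContDiffOn ℝ ∞ h h.source ∧ ContDiffOn ℝ ∞ h.symm h.target ∧
      ∀ z ∈ h.source, (h z).1 = g z := by
  set b : Fin 2 → E2 := fun i => EuclideanSpace.single i (1 : ℝ) with hb
  have key : ∀ u : E2, u = u 0 • b 0 + u 1 • b 1 := by
    intro u; ext i; fin_cases i <;> simp [hb]
  set α := fderiv ℝ g z₀ (b 0)
  set β := fderiv ℝ g z₀ (b 1)
  -- The second coordinate is linear with kernel spanned by the gradient of `g` at `z₀`. The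
  -- Jacobian determinant of `(g, l)` is `δ` below; restricting to `δ ≠ 0` makes the inverse smooth
  -- on the whole target.
  set l : E2 →L[ℝ] ℝ := α • EuclideanSpace.proj 1 - β • EuclideanSpace.proj 0 with hl
  have hlv : ∀ u : E2, l u = α * u 1 - β * u 0 := fun u => by simp [hl]
  have hdg : ContDiffOn ℝ ∞ (fderiv ℝ g) O := hg.fderiv_of_isOpen hO (m := ∞) (by simp)
  set δ : E2 → ℝ := fun z => α * fderiv ℝ g z (b 0) + β * fderiv ℝ g z (b 1) with hδ
  have hδc : ContinuousOn δ O :=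
    (continuousOn_const.mul (hdg.continuousOn.clm_apply continuousOn_const)).add
      (continuousOn_const.mul (hdg.continuousOn.clm_apply continuousOn_const))
  have hδ0 : δ z₀ ≠ 0 := by
    intro h0
    have h1 : α * α + β * β = 0 := h0
    have hα : α = 0 := by nlinarith [mul_self_nonneg α, mul_self_nonneg β]
    have hβ : β = 0 := by nlinarith [mul_self_nonneg α, mul_self_nonneg β]
    apply hne
    ext u
    rw [key u, map_add, map_smul, map_smul]
    change u 0 • α + u 1 • β = 0
    rw [hα, hβ]; simp
  set O' := O ∩ δ ⁻¹' {0}ᶜ with hO'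
  have hO'o : IsOpen O' := hδc.isOpen_inter_preimage hO isOpen_compl_singleton
  set G : E2 → ℝ × ℝ := fun z => (g z, l z) with hG
  have hGs : ContDiffOn ℝ ∞ G O := hg.prodMk l.contDiff.contDiffOn
  have hGd : ∀ z ∈ O', ∃ L : E2 ≃L[ℝ] ℝ × ℝ, HasFDerivAt G (L : E2 →L[ℝ] ℝ × ℝ) z := by
    intro z hz
    have hgd : DifferentiableAt ℝ g z :=
      (hg.contDiffAt (hO.mem_nhds hz.1)).differentiableAt (by simp)
    have hinj : Function.Injective ((fderiv ℝ g z).prod l) := by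
      rw [injective_iff_map_eq_zero]
      intro u hu
      have h1 : fderiv ℝ g z u = 0 := congrArg Prod.fst hu
      have h2 : l u = 0 := congrArg Prod.snd hu
      rw [hlv] at h2
      rw [key u, map_add, map_smul, map_smul, smul_eq_mul, smul_eq_mul] at h1
      have hδz : δ z ≠ 0 := hz.2
      have e0 : δ z * u 0 = 0 := by
        simp only [hδ]; linear_combination α * h1 - fderiv ℝ g z (b 1) * h2
      have e1 : δ z * u 1 = 0 := by
        simp only [hδ]; linear_combination β * h1 + fderiv ℝ g z (b 0) * h2
      rw [key u, (mul_eq_zero.1 e0).resolve_left hδz, (mul_eq_zero.1 e1).resolve_left hδz]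
      simp
    let L := (LinearEquiv.ofInjectiveOfFinrankEq ((fderiv ℝ g z).prod l : E2 →ₗ[ℝ] ℝ × ℝ)
      hinj (by simp)).toContinuousLinearEquiv
    refine ⟨L, ?_⟩
    have hL : (L : E2 →L[ℝ] ℝ × ℝ) = (fderiv ℝ g z).prod l := by ext u <;> rfl
    rw [hL]
    exact hgd.hasFDerivAt.prodMk l.hasFDerivAt
  obtain ⟨L₀, hL₀⟩ := hGd z₀ ⟨hz₀, hδ0⟩
  have hcd : ContDiffAt ℝ ∞ G z₀ := hGs.contDiffAt (hO.mem_nhds hz₀)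
  set h₁ := hcd.toOpenPartialHomeomorph G hL₀ (by simp) with hh₁
  have hcoe : ∀ z, h₁ z = G z := fun z => rfl
  set h := h₁.restrOpen O' hO'o with hh
  have hsrc : h.source = h₁.source ∩ O' := rfl
  refine ⟨h, ?_, ?_, ?_, ?_, ?_⟩
  · rw [hsrc]
    exact ⟨hcd.mem_toOpenPartialHomeomorph_source hL₀ (by simp), hz₀, hδ0⟩
  · rw [hsrc]; exact fun z hz => hz.2.1
  · exact (hGs.mono (by rw [hsrc]; exact fun z hz => hz.2.1)).congr fun z hz => rfl
  · intro a ha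
    have hm := h.map_target ha
    rw [hsrc] at hm
    obtain ⟨L, hL⟩ := hGd _ hm.2
    exact (h.contDiffAt_symm ha hL (hGs.contDiffAt (hO.mem_nhds hm.2.1))).contDiffWithinAt
  · intro z hz; rfl

/-! ### Charts adapted to a submersion -/

section Charts

variable {M : Type*} [TopologicalSpace M] [ChartedSpace E2 M]

/-- A chart with values in a coordinate rectangle whose first coordinate is `u`. -/
structure IsAdaptedChart (e : OpenPartialHomeomorph M (ℝ × ℝ)) (u : M → ℝ) (I J : Set ℝ) :
    Prop where
  target_eq : e.target = I ×ˢ J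
  isOpen_fst : IsOpen I
  isOpen_snd : IsOpen J
  ordConnected_fst : I.OrdConnected
  ordConnected_snd : J.OrdConnected
  smooth : ContMDiffOn 𝓘(ℝ, E2) 𝓘(ℝ, ℝ × ℝ) ∞ e e.source
  smooth_symm : ContMDiffOn 𝓘(ℝ, ℝ × ℝ) 𝓘(ℝ, E2) ∞ e.symm e.target
  fst_eq : ∀ q ∈ e.source, (e q).1 = u q

theorem exists_isAdaptedChart [IsManifold 𝓘(ℝ, E2) ∞ M] {U : Set M} (hU : IsOpen U) {u : M → ℝ}
    (hu : ContMDiffOn 𝓘(ℝ, E2) 𝓘(ℝ, ℝ) ∞ u U) {p : M} (hp : p ∈ U) (hne : fdiff u p ≠ 0) :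
    ∃ (e : OpenPartialHomeomorph M (ℝ × ℝ)) (I J : Set ℝ), IsAdaptedChart e u I J ∧
      p ∈ e.source ∧ e.source ⊆ U := by
  set φ := chartAt E2 p with hφ
  have hpφ : p ∈ φ.source := mem_chart_source E2 p
  set O := φ.target ∩ φ.symm ⁻¹' U with hO
  have hOo : IsOpen O := φ.symm.isOpen_inter_preimage hU
  have hg : ContDiffOn ℝ ∞ (u ∘ φ.symm) O := by
    rw [← contMDiffOn_iff_contDiffOn]
    exact hu.comp ((contMDiffOn_chart_symm (I := 𝓘(ℝ, E2)) (x := p)).mono Set.inter_subset_left)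
      fun z hz => hz.2
  have hzO : φ p ∈ O := ⟨φ.map_source hpφ, by simpa [φ.left_inv hpφ] using hp⟩
  have hφd : MDifferentiableAt 𝓘(ℝ, E2) 𝓘(ℝ, E2) φ p :=
    ((contMDiffOn_chart (I := 𝓘(ℝ, E2)) (n := ∞) (x := p)).contMDiffAt
      (φ.open_source.mem_nhds hpφ)).mdifferentiableAt (by simp)
  have hgne : fderiv ℝ (u ∘ φ.symm) (φ p) ≠ 0 := by
    intro h0
    apply hne
    have hgd : DifferentiableAt ℝ (u ∘ φ.symm) (φ p) :=
      (hg.contDiffAt (hOo.mem_nhds hzO)).differentiableAt (by simp)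
    have heq : u =ᶠ[nhds p] (u ∘ φ.symm) ∘ φ := by
      filter_upwards [φ.open_source.mem_nhds hpφ] with q hq
      simp [φ.left_inv hq]
    rw [fdiff, heq.mfderiv_eq, mfderiv_comp p hgd.mdifferentiableAt hφd, mfderiv_eq_fderiv, h0]
    exact ContinuousLinearMap.zero_comp _
  obtain ⟨h, hzh, hhO, hhs, hhs', hh1⟩ := exists_straightening hOo hg hzO hgne
  set e₁ := φ.trans h with he₁
  have hpe₁ : p ∈ e₁.source := by
    rw [he₁, OpenPartialHomeomorph.trans_source]; exact ⟨hpφ, hzh⟩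
  have hpt : e₁ p ∈ e₁.target := e₁.map_source hpe₁
  -- Balls in the product metric of `ℝ × ℝ` are rectangles.
  obtain ⟨ε, hε, hball⟩ := Metric.isOpen_iff.1 e₁.open_target _ hpt
  set I := Metric.ball (e₁ p).1 ε
  set J := Metric.ball (e₁ p).2 ε
  have hIJ : I ×ˢ J = Metric.ball (e₁ p) ε := ball_prod_same _ _ _
  have hIJo : IsOpen (I ×ˢ J) := Metric.isOpen_ball.prod Metric.isOpen_ball
  set e := (e₁.symm.restrOpen (I ×ˢ J) hIJo).symm with he
  have htar : e.target = I ×ˢ J := by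
    change e₁.target ∩ (I ×ˢ J) = _
    rw [Set.inter_eq_right, hIJ]; exact hball
  have hsub : e.target ⊆ e₁.target := by rw [htar, hIJ]; exact hball
  have hssub : e.source ⊆ e₁.source := by
    intro q hq
    have h1 : e.symm (e q) = q := e.left_inv hq
    have h2 := hsub (e.map_source hq)
    have h3 : e₁.symm (e q) = q := h1
    rw [← h3]
    exact e₁.map_target h2
  have hs₁ : ∀ q ∈ e₁.source, q ∈ φ.source ∧ φ q ∈ h.source := fun q hq => by
    rw [he₁, OpenPartialHomeomorph.trans_source] at hq; exact hq
  have ht₁ : ∀ z ∈ e₁.target, z ∈ h.target ∧ h.symm z ∈ φ.target := fun z hz => by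
    rw [he₁, OpenPartialHomeomorph.trans_target] at hz; exact hz
  refine ⟨e, I, J, ⟨htar, Metric.isOpen_ball, Metric.isOpen_ball,
    (convex_ball _ _).ordConnected, (convex_ball _ _).ordConnected, ?_, ?_, ?_⟩, ?_, ?_⟩
  · exact (contMDiffOn_iff_contDiffOn.2 hhs).comp
      ((contMDiffOn_chart (I := 𝓘(ℝ, E2)) (n := ∞) (x := p)).mono
        fun q hq => (hs₁ q (hssub hq)).1) fun q hq => (hs₁ q (hssub hq)).2
  · exact (contMDiffOn_chart_symm (I := 𝓘(ℝ, E2)) (n := ∞) (x := p)).comp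
      ((contMDiffOn_iff_contDiffOn.2 hhs').mono fun z hz => (ht₁ z (hsub hz)).1)
      fun z hz => (ht₁ z (hsub hz)).2
  · intro q hq
    have := hs₁ q (hssub hq)
    change (h (φ q)).1 = u q
    rw [hh1 _ this.2, Function.comp_apply, φ.left_inv this.1]
  · have h1 : e₁ p ∈ e.target := by rw [htar, hIJ]; exact Metric.mem_ball_self hε
    have h2 := e.map_target h1
    have h3 : e.symm (e₁ p) = p := e₁.left_inv hpe₁
    rwa [h3] at h2
  · intro q hq
    have := hs₁ q (hssub hq)
    have h2 := (hhO this.2).2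
    rwa [Set.mem_preimage, φ.left_inv this.1] at h2

/-- The differential of the parametrization inverse to a chart. -/
noncomputable def push (e : OpenPartialHomeomorph M (ℝ × ℝ)) (z : ℝ × ℝ) :
    (ℝ × ℝ) →L[ℝ] TangentSpace 𝓘(ℝ, E2) (e.symm z) :=
  mfderiv 𝓘(ℝ, ℝ × ℝ) 𝓘(ℝ, E2) e.symm z

namespace IsAdaptedChart

variable {e : OpenPartialHomeomorph M (ℝ × ℝ)} {u : M → ℝ} {I J : Set ℝ}
  (h : IsAdaptedChart e u I J) {z : ℝ × ℝ}

include h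

theorem mem_target (hz : z ∈ I ×ˢ J) : z ∈ e.target := by rw [h.target_eq]; exact hz

theorem mem_box {q : M} (hq : q ∈ e.source) : e q ∈ I ×ˢ J := by
  rw [← h.target_eq]; exact e.map_source hq

theorem mdifferentiable : e.MDifferentiable 𝓘(ℝ, E2) 𝓘(ℝ, ℝ × ℝ) :=
  ⟨h.smooth.mdifferentiableOn (by simp), h.smooth_symm.mdifferentiableOn (by simp)⟩

theorem push_bijective [IsManifold 𝓘(ℝ, E2) ∞ M] (hz : z ∈ I ×ˢ J) :
    Function.Bijective (push e z) := 
  h.mdifferentiable.symm.mfderiv_bijective (h.mem_target hz)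

theorem diff_push {x : M → E3} (hx : MDifferentiableAt 𝓘(ℝ, E2) 𝓘(ℝ, E3) x (e.symm z))
    (hz : z ∈ I ×ˢ J) (w : ℝ × ℝ) : diff x (e.symm z) (push e z w) = pd w (x ∘ e.symm) z := by
  have h1 : MDifferentiableAt 𝓘(ℝ, ℝ × ℝ) 𝓘(ℝ, E2) e.symm z :=
    h.mdifferentiable.mdifferentiableAt_symm (h.mem_target hz)
  rw [pd, ← mfderiv_eq_fderiv, mfderiv_comp z hx h1]
  rfl

theorem fdiff_push {f : M → ℝ} (hf : MDifferentiableAt 𝓘(ℝ, E2) 𝓘(ℝ, ℝ) f (e.symm z))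
    (hz : z ∈ I ×ˢ J) (w : ℝ × ℝ) : fdiff f (e.symm z) (push e z w) = pd w (f ∘ e.symm) z := by
  have h1 : MDifferentiableAt 𝓘(ℝ, ℝ × ℝ) 𝓘(ℝ, E2) e.symm z :=
    h.mdifferentiable.mdifferentiableAt_symm (h.mem_target hz)
  rw [pd, ← mfderiv_eq_fderiv, mfderiv_comp z hf h1]
  rfl

end IsAdaptedChart

end Charts

theorem curvatures_of_principal {M : Type*} [TopologicalSpace M] [ChartedSpace E2 M]
    {y n : M → E3} {p : M} (hreg : IsRegularAt y p) {v w : TangentSpace 𝓘(ℝ, E2) p}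
    (hv : v ≠ 0) (hw : w ≠ 0) (hvw : ⟪diff y p v, diff y p w⟫ = 0) {k l : ℝ}
    (hk : diff n p v = -(k • diff y p v)) (hl : diff n p w = -(l • diff y p w)) :
    gaussCurvature y n p = k * l ∧ meanCurvature y n p = (k + l) / 2 := by
  have := det_trace_gram (diff y p) (diff n p) hreg hv hw hvw hk hl (tangentBasis p)
    (fun i => rfl)
  exact ⟨this.1, congrArg (· / 2) this.2⟩

theorem pd_eq_nabla_add {V : Type*} [NormedAddCommGroup V] [NormedSpace ℝ V]
    (X : ℝ × ℝ → E3) (f : ℝ × ℝ → V) (z w : ℝ × ℝ) :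
    pd w f z = w.1 • nabla X f z + (w.2 + w.1 * shift X z) • pd et f z := by
  rw [nabla_eq, pd_eq]
  module

/-- A property that is locally all-or-nothing holds everywhere if it holds somewhere. -/
theorem forall_of_locally {M : Type*} [TopologicalSpace M] [PreconnectedSpace M] {P : M → Prop}
    (hP : ∀ p, ∃ V ∈ nhds p, ∀ q ∈ V, ∀ q' ∈ V, P q → P q') {p : M} (hp : P p) (q : M) : P q := by
  have hl : IsLocallyConstant P := by
    rw [IsLocallyConstant.iff_eventually_eq]
    intro p
    obtain ⟨V, hV, h⟩ := hP p
    filter_upwards [hV] with q hq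
    exact propext ⟨h q hq p (mem_of_mem_nhds hV), h p (mem_of_mem_nhds hV) q hq⟩
  rw [hl.apply_eq_of_preconnectedSpace q p]
  exact hp

/-! ### From the surface to patches: tubes, channel charts and principal frames -/

section Surface

variable {M : Type*} [TopologicalSpace M] [ChartedSpace E2 M] {x n : M → E3}

theorem IsNormalField.mdiffAt_map (hS : IsNormalField x n) (p : M) :
    MDifferentiableAt 𝓘(ℝ, E2) 𝓘(ℝ, E3) x p :=
  hS.smooth_map.contMDiffAt.mdifferentiableAt (by simp)

theorem IsNormalField.mdiffAt_normal (hS : IsNormalField x n) (p : M) :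
    MDifferentiableAt 𝓘(ℝ, E2) 𝓘(ℝ, E3) n p :=
  hS.smooth_normal.contMDiffAt.mdifferentiableAt (by simp)

theorem IsNormalField.smooth_parallel (hS : IsNormalField x n) (t : ℝ) :
    ContMDiff 𝓘(ℝ, E2) 𝓘(ℝ, E3) ∞ (parallel x n t) := by
  have h1 : ContMDiff 𝓘(ℝ, E3) 𝓘(ℝ, E3) ∞ (fun v : E3 => t • v) :=
    (contDiff_id.const_smul t).contMDiff
  exact hS.smooth_map.add (h1.comp hS.smooth_normal)

theorem IsNormalField.diff_parallel (hS : IsNormalField x n) (t : ℝ) (p : M)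
    (v : TangentSpace 𝓘(ℝ, E2) p) :
    diff (parallel x n t) p v = diff x p v + t • diff n p v := by
  have h1 : parallel x n t = x + t • n := rfl
  unfold diff
  rw [h1, mfderiv_add (hS.mdiffAt_map p) ((hS.mdiffAt_normal p).const_smul t),
    const_smul_mfderiv (hS.mdiffAt_normal p)]
  rfl

namespace IsAdaptedChart

variable {e : OpenPartialHomeomorph M (ℝ × ℝ)} {u : M → ℝ} {I J : Set ℝ}
  (h : IsAdaptedChart e u I J) {z : ℝ × ℝ}

include h

theorem contMDiffOn_fst : ContMDiffOn 𝓘(ℝ, E2) 𝓘(ℝ, ℝ) ∞ u e.source := by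
  have h1 : ContMDiff 𝓘(ℝ, ℝ × ℝ) 𝓘(ℝ, ℝ) ∞ (Prod.fst : ℝ × ℝ → ℝ) := contDiff_fst.contMDiff
  exact (h1.comp_contMDiffOn h.smooth).congr fun q hq => (h.fst_eq q hq).symm

theorem fdiff_fst (hz : z ∈ I ×ˢ J) (w : ℝ × ℝ) : fdiff u (e.symm z) (push e z w) = w.1 := by
  have hq := e.map_target (h.mem_target hz)
  have hd : MDifferentiableAt 𝓘(ℝ, E2) 𝓘(ℝ, ℝ) u (e.symm z) :=
    (h.contMDiffOn_fst.contMDiffAt (e.open_source.mem_nhds hq)).mdifferentiableAt (by simp)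
  rw [h.fdiff_push hd hz, pd_congr (h.isOpen_fst.prod h.isOpen_snd) (g := Prod.fst) _ hz]
  · simp [pd, fderiv_fst]
  · intro y hy
    have := h.fst_eq _ (e.map_target (h.mem_target hy))
    rw [e.right_inv (h.mem_target hy)] at this
    exact this.symm

theorem fdiff_ne {q : M} (hq : q ∈ e.source) : fdiff u q ≠ 0 := by
  intro h0
  have h1 := h.fdiff_fst (h.mem_box hq) es
  rw [e.left_inv hq, h0] at h1
  exact zero_ne_one h1

theorem contDiffOn_comp_symm {f : M → E3} (hf : ContMDiff 𝓘(ℝ, E2) 𝓘(ℝ, E3) ∞ f) :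
    ContDiffOn ℝ ∞ (f ∘ e.symm) (I ×ˢ J) := by
  rw [← contMDiffOn_iff_contDiffOn, ← h.target_eq]
  exact hf.comp_contMDiffOn h.smooth_symm

theorem isPatch [IsManifold 𝓘(ℝ, E2) ∞ M] (hS : IsSurface x n) {k : M → ℝ}
    (hk : ∀ q ∈ e.source, ∀ v, fdiff u q v = 0 → diff n q v = -(k q • diff x q v)) :
    IsPatch I J (x ∘ e.symm) (n ∘ e.symm) (k ∘ e.symm) where
  isOpen_fst := h.isOpen_fst
  isOpen_snd := h.isOpen_snd
  ordConnected_fst := h.ordConnected_fst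
  ordConnected_snd := h.ordConnected_snd
  smooth_map := h.contDiffOn_comp_symm hS.smooth_map
  smooth_normal := h.contDiffOn_comp_symm hS.smooth_normal
  unit z hz := by
    rw [real_inner_self_eq_norm_sq, Function.comp_apply, hS.unit]; norm_num
  normal z hz w := by
    rw [← h.diff_push (hS.mdiffAt_map _) hz, real_inner_comm]
    exact hS.normal _ _
  regular z hz w h0 := by
    rw [← h.diff_push (hS.mdiffAt_map _) hz] at h0
    have h1 : push e z w = 0 := hS.regular (e.symm z) (by rw [h0, map_zero])
    exact (h.push_bijective hz).1 (by rw [h1, map_zero])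
  curvature_line z hz := by
    rw [← h.diff_push (hS.mdiffAt_map _) hz, ← h.diff_push (hS.mdiffAt_normal _) hz]
    exact hk _ (e.map_target (h.mem_target hz)) _ (h.fdiff_fst hz et)

end IsAdaptedChart

/-- The map `x + κ⁻¹ • n` is stationary along the level curves of `u`, so locally it is a curve in
the parameter `u`. This is the centre curve: its derivative is tangential to the surface, hence
orthogonal to `n`. -/
theorem isTube_of_local [IsManifold 𝓘(ℝ, E2) ∞ M] (hS : IsSurface x n) {κ : ℝ} (hκ : κ ≠ 0)
    (hloc : ∀ p, ∃ (U : Set M) (u : M → ℝ), IsOpen U ∧ p ∈ U ∧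
      ContMDiffOn 𝓘(ℝ, E2) 𝓘(ℝ, ℝ) ∞ u U ∧ fdiff u p ≠ 0 ∧
      ∀ q ∈ U, ∀ v, fdiff u q v = 0 → diff n q v = -(κ • diff x q v)) : IsTube x := by
  refine ⟨|κ|⁻¹, inv_pos.2 (abs_pos.2 hκ), fun p => ?_⟩
  obtain ⟨U, u, hU, hpU, hu, hne, hkd⟩ := hloc p
  obtain ⟨e, I, J, he, hpe, heU⟩ := exists_isAdaptedChart hU hu hpU hne
  have hP := he.isPatch hS (k := fun _ => κ) fun q hq v hv => hkd q (heU hq) v hv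
  set Y : ℝ × ℝ → E3 := fun z => (x ∘ e.symm) z + κ⁻¹ • (n ∘ e.symm) z with hY
  have hκn : ContDiffOn ℝ ∞ (fun z => κ⁻¹ • (n ∘ e.symm) z) (I ×ˢ J) :=
    hP.smooth_normal.const_smul κ⁻¹
  have hYs : ContDiffOn ℝ ∞ Y (I ×ˢ J) := hP.smooth_map.add hκn
  have hYpd : ∀ z ∈ I ×ˢ J, ∀ w, pd w Y z = pd w (x ∘ e.symm) z + κ⁻¹ • pd w (n ∘ e.symm) z := by
    intro z hz w
    rw [hY, pd_add (hP.diffAt hP.smooth_map hz) (hP.diffAt hκn hz),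
      pd_smul (differentiableAt_const _) (hP.diffAt hP.smooth_normal hz)]
    simp [pd]
  have hY0 : ∀ z ∈ I ×ˢ J, pd et Y z = 0 := by
    intro z hz
    rw [hYpd z hz, hP.curvature_line z hz, Function.comp_apply, smul_neg, smul_smul,
      inv_mul_cancel₀ hκ, one_smul, add_neg_cancel]
  have ht₀ : (e p).2 ∈ J := (he.mem_box hpe).2
  refine ⟨e.source, u, I, fun s => Y (s, (e p).2), e.open_source, hpe, he.contMDiffOn_fst,
    fun q hq => he.fdiff_ne hq, he.isOpen_fst, fun q hq => ?_,
    hYs.comp (by fun_prop) fun s hs => ⟨hs, ht₀⟩, fun q hq => ?_⟩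
  · rw [← he.fst_eq q hq]; exact (he.mem_box hq).1
  · have hz := he.mem_box hq
    have hslice : ∀ s ∈ I, Y (s, (e p).2) = Y (s, (e q).2) := fun s hs =>
      hP.eq_of_pd_eq_zero hYs hY0 ⟨hs, ht₀⟩ ⟨hs, hz.2⟩
    have hval : Y (u q, (e p).2) = x q + κ⁻¹ • n q := by
      rw [← he.fst_eq q hq, hslice _ hz.1]
      change x (e.symm (e q)) + κ⁻¹ • n (e.symm (e q)) = _
      rw [e.left_inv hq]
    have hder : deriv (fun s => Y (s, (e p).2)) (u q) = pd es Y (e q) := by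
      rw [← he.fst_eq q hq]
      have h1 : (fun s => Y (s, (e p).2)) =ᶠ[nhds (e q).1] fun s => Y (s, (e q).2) :=
        Filter.eventually_of_mem (he.isOpen_fst.mem_nhds hz.1) hslice
      rw [h1.deriv_eq]
      exact (hP.hasDerivAt_fst hYs hz).deriv
    have hxn : x q - (x q + κ⁻¹ • n q) = -(κ⁻¹ • n q) := by abel
    simp only
    rw [hval, hder, hxn]
    constructor
    · rw [norm_neg, norm_smul, hS.unit, mul_one, norm_inv, Real.norm_eq_abs]
    · have h1 := hP.normal _ hz es
      have h2 := hP.inner_pd_normal hz es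
      rw [Function.comp_apply, e.left_inv hq] at h1 h2
      rw [hYpd _ hz, inner_neg_left, real_inner_smul_left, inner_add_right, h1,
        real_inner_smul_right, real_inner_comm, h2]
      simp

/-- An adapted chart for the foliation of a channel surface. -/
structure IsChannelChart (x n : M → E3) (D : (p : M) → Submodule ℝ (TangentSpace 𝓘(ℝ, E2) p))
    (k : M → ℝ) (e : OpenPartialHomeomorph M (ℝ × ℝ)) (u : M → ℝ) (I J : Set ℝ) : Prop
    extends IsAdaptedChart e u I J where
  mem_iff : ∀ q ∈ e.source, ∀ v, v ∈ D q ↔ fdiff u q v = 0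
  patch : IsPatch I J (x ∘ e.symm) (n ∘ e.symm) (k ∘ e.symm)
  pd_curv : ∀ z ∈ I ×ˢ J, pd et (k ∘ e.symm) z = 0

/-- The principal curvature across the leaves. -/
noncomputable def otherCurvature (x n : M → E3) (k : M → ℝ) (p : M) : ℝ :=
  2 * meanCurvature x n p - k p

section Channel

variable [IsManifold 𝓘(ℝ, E2) ∞ M] (hS : IsSurface x n)
  {D : (p : M) → Submodule ℝ (TangentSpace 𝓘(ℝ, E2) p)} {k : M → ℝ}

include hS

theorem exists_isChannelChart (hk : ∀ p, ∀ v ∈ D p, diff n p v = -(k p • diff x p v))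
    (hD : ∀ p, ∃ (U : Set M) (u : M → ℝ), IsOpen U ∧ p ∈ U ∧
      ContMDiffOn 𝓘(ℝ, E2) 𝓘(ℝ, ℝ) ∞ u U ∧
      (∀ q ∈ U, fdiff u q ≠ 0 ∧ ∀ v, v ∈ D q ↔ fdiff u q v = 0) ∧
      ∀ s : ℝ, LiesOnCircleOrLine (x '' {q | q ∈ U ∧ u q = s})) (p : M) :
    ∃ (e : OpenPartialHomeomorph M (ℝ × ℝ)) (u : M → ℝ) (I J : Set ℝ),
      IsChannelChart x n D k e u I J ∧ p ∈ e.source := by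
  obtain ⟨U, u, hU, hpU, hu, hne, hC⟩ := hD p
  obtain ⟨e, I, J, he, hpe, heU⟩ := exists_isAdaptedChart hU hu hpU (hne p hpU).1
  have hP := he.isPatch hS (k := k) fun q hq v hv => hk q v (((hne q (heU hq)).2 v).2 hv)
  refine ⟨e, u, I, J, ⟨he, fun q hq => (hne q (heU hq)).2, hP,
    fun z hz => hP.pd_curv_of_liesOnCircleOrLine (fun s => ?_) hz⟩, hpe⟩
  have hsub : (x ∘ e.symm) '' {z | z ∈ I ×ˢ J ∧ z.1 = s} ⊆ x '' {q | q ∈ U ∧ u q = s} := by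
    rintro _ ⟨z, ⟨hz, rfl⟩, rfl⟩
    have hq := e.map_target (he.mem_target hz)
    refine ⟨e.symm z, ⟨heU hq, ?_⟩, rfl⟩
    rw [← he.fst_eq _ hq, e.right_inv (he.mem_target hz)]
  rcases hC s with ⟨c, τ, r, hτ, hr, hc⟩ | ⟨c, τ, hτ, hc⟩
  · exact Or.inl ⟨c, τ, r, hτ, hr, fun y hy => hc y (hsub hy)⟩
  · exact Or.inr ⟨c, τ, hτ, fun y hy => hc y (hsub hy)⟩

namespace IsChannelChart

variable {e : OpenPartialHomeomorph M (ℝ × ℝ)} {u : M → ℝ} {I J : Set ℝ}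
  (h : IsChannelChart x n D k e u I J) {z : ℝ × ℝ}

include h

theorem curvatures (hz : z ∈ I ×ˢ J) :
    gaussCurvature x n (e.symm z) = (k ∘ e.symm) z * crossCurv (x ∘ e.symm) (n ∘ e.symm) z ∧
      meanCurvature x n (e.symm z)
        = ((k ∘ e.symm) z + crossCurv (x ∘ e.symm) (n ∘ e.symm) z) / 2 := by
  have hb := h.push_bijective hz
  have hx := h.diff_push (hS.mdiffAt_map (e.symm z)) hz
  have hn := h.diff_push (hS.mdiffAt_normal (e.symm z)) hz
  refine curvatures_of_principal (hS.regular _) (v := push e z et)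
    (w := push e z (1, -shift (x ∘ e.symm) z)) ?_ ?_ ?_ ?_ ?_
  · exact fun h0 => by simpa using hb.1 (h0.trans (map_zero (push e z)).symm)
  · exact fun h0 => by simpa using hb.1 (h0.trans (map_zero (push e z)).symm)
  · rw [hx, hx]; exact h.patch.inner_leaf_cross hz
  · rw [hx, hn]; exact h.patch.curvature_line z hz
  · rw [hx, hn]; exact h.patch.nabla_normal hz

theorem otherCurvature_eq (hz : z ∈ I ×ˢ J) :
    otherCurvature x n k (e.symm z) = crossCurv (x ∘ e.symm) (n ∘ e.symm) z := by
  rw [otherCurvature, (h.curvatures hS hz).2, Function.comp_apply]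
  ring

end IsChannelChart

/-- A basis of principal directions. -/
theorem exists_principal_frame
    (hch : ∀ p, ∃ (e : OpenPartialHomeomorph M (ℝ × ℝ)) (u : M → ℝ) (I J : Set ℝ),
      IsChannelChart x n D k e u I J ∧ p ∈ e.source) (p : M) :
    ∃ v w : TangentSpace 𝓘(ℝ, E2) p, v ≠ 0 ∧ w ≠ 0 ∧ ⟪diff x p v, diff x p w⟫ = 0 ∧
      diff n p v = -(k p • diff x p v) ∧ diff n p w = -(otherCurvature x n k p • diff x p w) ∧
      (∀ v', ∃ α β : ℝ, v' = α • v + β • w) ∧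
      gaussCurvature x n p = k p * otherCurvature x n k p := by
  obtain ⟨e, u, I, J, h, hp⟩ := hch p
  obtain ⟨z, hz, rfl⟩ : ∃ z ∈ I ×ˢ J, p = e.symm z := ⟨e p, h.mem_box hp, (e.left_inv hp).symm⟩
  have hb := h.push_bijective hz
  have hx := h.diff_push (hS.mdiffAt_map (e.symm z)) hz
  have hn := h.diff_push (hS.mdiffAt_normal (e.symm z)) hz
  refine ⟨push e z et, push e z (1, -shift (x ∘ e.symm) z), ?_, ?_, ?_, ?_, ?_, ?_, ?_⟩
  · exact fun h0 => by simpa using hb.1 (h0.trans (map_zero (push e z)).symm)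
  · exact fun h0 => by simpa using hb.1 (h0.trans (map_zero (push e z)).symm)
  · rw [hx, hx]; exact h.patch.inner_leaf_cross hz
  · rw [hx, hn]; exact h.patch.curvature_line z hz
  · rw [hx, hn, h.otherCurvature_eq hS hz]; exact h.patch.nabla_normal hz
  · intro v'
    obtain ⟨w, rfl⟩ := hb.2 v'
    refine ⟨w.2 + w.1 * shift (x ∘ e.symm) z, w.1, ?_⟩
    rw [← map_smul, ← map_smul, ← map_add]
    exact congrArg (push e z) (by ext <;> simp)
  · rw [(h.curvatures hS hz).1, h.otherCurvature_eq hS hz]; rfl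

end Channel

end Surface

/-! ### Global alternatives on a connected surface, and parallel surfaces -/

section Global

variable {M : Type*} [TopologicalSpace M] [ChartedSpace E2 M] [IsManifold 𝓘(ℝ, E2) ∞ M]
  {x n : M → E3} {D : (p : M) → Submodule ℝ (TangentSpace 𝓘(ℝ, E2) p)} {k : M → ℝ}
  (hS : IsSurface x n)
  (hch : ∀ p, ∃ (e : OpenPartialHomeomorph M (ℝ × ℝ)) (u : M → ℝ) (I J : Set ℝ),
    IsChannelChart x n D k e u I J ∧ p ∈ e.source)
  {a b c : ℝ}
  (hW : ∀ p, a * gaussCurvature x n p + 2 * b * meanCurvature x n p + c = 0)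

namespace IsChannelChart

variable {e : OpenPartialHomeomorph M (ℝ × ℝ)} {u : M → ℝ} {I J : Set ℝ}
  (h : IsChannelChart x n D k e u I J) {z : ℝ × ℝ}

include hS hW h in
theorem weingarten (hz : z ∈ I ×ˢ J) :
    a * ((k ∘ e.symm) z * crossCurv (x ∘ e.symm) (n ∘ e.symm) z) +
      b * ((k ∘ e.symm) z + crossCurv (x ∘ e.symm) (n ∘ e.symm) z) + c = 0 := by
  have h1 := hW (e.symm z)
  rw [(h.curvatures hS hz).1, (h.curvatures hS hz).2] at h1
  linarith

omit [IsManifold 𝓘(ℝ, E2) ∞ M] in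
include h in
theorem exists_eq {p : M} (hp : p ∈ e.source) : ∃ z ∈ I ×ˢ J, p = e.symm z :=
  ⟨e p, h.mem_box hp, (e.left_inv hp).symm⟩

omit [IsManifold 𝓘(ℝ, E2) ∞ M] in
include h in
theorem symm_mem (hz : z ∈ I ×ˢ J) : e.symm z ∈ e.source := e.map_target (h.mem_target hz)

omit [IsManifold 𝓘(ℝ, E2) ∞ M] in
include h in
theorem eventually_symm {P : M → Prop} (hz : z ∈ I ×ˢ J) (hP : ∀ᶠ q in nhds (e.symm z), P q) :
    ∀ᶠ y in nhds z, P (e.symm y) :=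
  (e.continuousAt_symm (h.mem_target hz)).eventually hP

end IsChannelChart

include hS hch in
theorem isTube_of_curvature_eq {κ : ℝ} (hκ : κ ≠ 0) (hk : ∀ p, k p = κ) : IsTube x := by
  refine isTube_of_local hS hκ fun p => ?_
  obtain ⟨e, u, I, J, h, hp⟩ := hch p
  refine ⟨e.source, u, e.open_source, hp, h.contMDiffOn_fst, h.fdiff_ne hp, fun q hq v hv => ?_⟩
  obtain ⟨z, hz, rfl⟩ := h.exists_eq hq
  obtain ⟨w, rfl⟩ := (h.push_bijective hz).2 v
  rw [h.fdiff_fst hz] at hv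
  rw [h.diff_push (hS.mdiffAt_map _) hz, h.diff_push (hS.mdiffAt_normal _) hz]
  have hw : w = w.2 • et := by ext <;> simp [hv]
  have h1 := h.patch.curvature_line z hz
  rw [Function.comp_apply, hk] at h1
  rw [hw, pd_smul_dir, pd_smul_dir, h1]
  module

-- The curvature lines across the leaves now play the role of the circles. The map `x + κ⁻¹ • n` is
-- stationary along them but moves along the leaves, so a linear function of it serves as the
-- parameter.
include hS hch in
theorem isTube_of_otherCurvature_eq {κ : ℝ} (hκ : κ ≠ 0) (hk : ∀ p, k p ≠ κ)
    (hl : ∀ p, otherCurvature x n k p = κ) : IsTube x := by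
  refine isTube_of_local hS hκ fun p => ?_
  obtain ⟨e, u, I, J, h, hp⟩ := hch p
  obtain ⟨z₀, hz₀, rfl⟩ := h.exists_eq hp
  have hP := h.patch
  set X := x ∘ e.symm with hX
  set N := n ∘ e.symm with hN
  have hyd : ∀ q, MDifferentiableAt 𝓘(ℝ, E2) 𝓘(ℝ, E3) (parallel x n κ⁻¹) q := fun q =>
    (hS.mdiffAt_map q).add ((hS.mdiffAt_normal q).const_smul κ⁻¹)
  have hys : ContMDiff 𝓘(ℝ, E2) 𝓘(ℝ, E3) ∞ (parallel x n κ⁻¹) :=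
    hS.smooth_parallel κ⁻¹
  set Y := parallel x n κ⁻¹ ∘ e.symm with hY
  have hYs : ContDiffOn ℝ ∞ Y (I ×ˢ J) := h.contDiffOn_comp_symm hys
  have hYpd : ∀ z ∈ I ×ˢ J, ∀ w, pd w Y z = pd w X z + κ⁻¹ • pd w N z := by
    intro z hz w
    rw [hY, ← h.diff_push (hyd _) hz, hS.diff_parallel, h.diff_push (hS.mdiffAt_map _) hz,
      h.diff_push (hS.mdiffAt_normal _) hz]
  have hNn : ∀ z ∈ I ×ˢ J, nabla X N z = -(κ • nabla X X z) := by
    intro z hz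
    rw [hP.nabla_normal hz, ← h.otherCurvature_eq hS hz, hl]; rfl
  have hYn : ∀ z ∈ I ×ˢ J, nabla X Y z = 0 := by
    intro z hz
    have h1 : nabla X Y z = nabla X X z + κ⁻¹ • nabla X N z := hYpd z hz _
    rw [h1, hNn z hz, smul_neg, smul_smul, inv_mul_cancel₀ hκ, one_smul, add_neg_cancel]
  -- The parameter is `⟪Y, d⟫`. Where `⟪pd et Y, d⟫ ≠ 0`, its differential vanishes exactly on the
  -- direction of `nabla`, and this holds near `z₀`.
  set d := pd et Y z₀ with hd
  have hd0 : d ≠ 0 := by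
    rw [hd, hYpd z₀ hz₀, hP.curvature_line z₀ hz₀, smul_neg, smul_smul, ← sub_eq_add_neg]
    intro h0
    have h1 : (1 - κ⁻¹ * k (e.symm z₀)) • pd et X z₀ = 0 := by
      rw [sub_smul, one_smul]; exact h0
    have h2 := (smul_eq_zero.1 h1).resolve_right (hP.leaf_ne hz₀)
    apply hk (e.symm z₀)
    field_simp at h2
    linarith
  set W := (I ×ˢ J) ∩ (fun z => ⟪pd et Y z, d⟫) ⁻¹' {0}ᶜ with hWd
  have hWo : IsOpen W :=
    ((hP.smooth_pd hYs et).inner ℝ contDiffOn_const).continuousOn.isOpen_inter_preimage hP.isOpen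
      isOpen_compl_singleton
  set f : M → ℝ := fun q => ⟪parallel x n κ⁻¹ q, d⟫ with hf
  have hfs : ContMDiff 𝓘(ℝ, E2) 𝓘(ℝ, ℝ) ∞ f := by
    have h1 : ContMDiff 𝓘(ℝ, E3) 𝓘(ℝ, ℝ) ∞ (fun v : E3 => ⟪v, d⟫) :=
      (contDiff_id.inner ℝ contDiff_const).contMDiff
    exact h1.comp hys
  have hfpd : ∀ z ∈ I ×ˢ J, ∀ w, fdiff f (e.symm z) (push e z w) = ⟪pd w Y z, d⟫ := by
    intro z hz w
    rw [h.fdiff_push (hfs.contMDiffAt.mdifferentiableAt (by simp)) hz]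
    change pd w (fun z => ⟪Y z, d⟫) z = _
    rw [pd_inner (hP.diffAt hYs hz) (differentiableAt_const _)]
    simp [pd]
  refine ⟨e.source ∩ e ⁻¹' W, f, e.isOpen_inter_preimage hWo, ⟨hp, ?_⟩, hfs.contMDiffOn, ?_, ?_⟩
  · rw [Set.mem_preimage, e.right_inv (h.mem_target hz₀)]
    exact ⟨hz₀, (real_inner_self_pos.2 hd0).ne'⟩
  · intro h0
    have h1 := hfpd z₀ hz₀ et
    rw [h0, ← hd] at h1
    exact (real_inner_self_pos.2 hd0).ne h1
  · rintro q ⟨hq, hqW⟩ v hv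
    obtain ⟨z, hz, rfl⟩ := h.exists_eq hq
    rw [Set.mem_preimage, e.right_inv (h.mem_target hz)] at hqW
    obtain ⟨w, rfl⟩ := (h.push_bijective hz).2 v
    rw [hfpd z hz, pd_eq_nabla_add X Y, hYn z hz, smul_zero, zero_add, real_inner_smul_left] at hv
    have h1 := (mul_eq_zero.1 hv).resolve_right hqW.2
    rw [h.diff_push (hS.mdiffAt_map _) hz, h.diff_push (hS.mdiffAt_normal _) hz,
      pd_eq_nabla_add X (x ∘ e.symm), pd_eq_nabla_add X (n ∘ e.symm), h1, ← hX, ← hN, hNn z hz]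
    module

variable [ConnectedSpace M]

include hS hch hW in
theorem isTubular_of_disc_eq_zero (habc : a ≠ 0 ∨ b ≠ 0 ∨ c ≠ 0) (hd : b ^ 2 - a * c = 0) :
    IsTubular x n := by
  obtain ⟨p₀⟩ : Nonempty M := inferInstance
  have hK : ∀ p, gaussCurvature x n p = k p * otherCurvature x n k p := fun p => by
    obtain ⟨_, _, _, _, _, _, _, _, hK⟩ := exists_principal_frame hS hch p
    exact hK
  have hkl : ∀ p, a * (k p * otherCurvature x n k p) + b * (k p + otherCurvature x n k p) + c = 0 :=
    fun p => by
    have := hW p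
    rw [hK] at this
    rw [← this, otherCurvature]; ring
  have ha : a ≠ 0 := by
    rintro rfl
    have hb : b = 0 := by simpa using hd
    have := hkl p₀
    simp [hb] at this
    simp [hb, this] at habc
  -- For vanishing discriminant, the relation multiplied by `a` is the product `(a k + b)(a l + b) =
  -- 0`.
  have hmul : ∀ p, (k p - -b / a) * (otherCurvature x n k p - -b / a) = 0 := fun p => by
    have := hkl p
    field_simp
    linear_combination a * this + hd
  by_cases hb : b = 0
  · refine Or.inr (Or.inl fun p => ?_)
    have := hmul p
    rw [hK]
    simpa [hb] using this
  have hκ : -b / a ≠ 0 := div_ne_zero (neg_ne_zero.2 hb) ha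
  refine Or.inl ?_
  by_cases hex : ∃ p, k p = -b / a
  · obtain ⟨p, hp⟩ := hex
    refine isTube_of_curvature_eq hS hch hκ
      (forall_of_locally (P := fun p => k p = -b / a) (fun p => ?_) hp)
    obtain ⟨e, u, I, J, h, hp⟩ := hch p
    refine ⟨e.source, e.open_source.mem_nhds hp, fun q hq q' hq' h0 => ?_⟩
    obtain ⟨z, hz, rfl⟩ := h.exists_eq hq
    obtain ⟨y, hy, rfl⟩ := h.exists_eq hq'
    refine h.patch.curv_eq_const_of_eq h.pd_curv (κ := -b / a) (fun z hz => ?_) hz h0 hy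
    rw [← h.otherCurvature_eq hS hz]
    exact hmul _
  · push Not at hex
    refine isTube_of_otherCurvature_eq hS hch hκ hex fun p => ?_
    exact sub_eq_zero.1 ((mul_eq_zero.1 (hmul p)).resolve_left (sub_ne_zero.2 (hex p)))

include hS hch hW in
theorem umbilic_dichotomy (hd : b ^ 2 - a * c ≠ 0) :
    IsTotallyUmbilic x n ∨ ∀ p, k p ≠ otherCurvature x n k p := by
  by_cases hex : ∃ p, k p = otherCurvature x n k p
  · left
    obtain ⟨p, hp⟩ := hex
    have hall := forall_of_locally (P := fun p => k p = otherCurvature x n k p) (fun p => by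
      obtain ⟨e, u, I, J, h, hp⟩ := hch p
      refine ⟨e.source, e.open_source.mem_nhds hp, fun q hq q' hq' h0 => ?_⟩
      obtain ⟨z, hz, rfl⟩ := h.exists_eq hq
      obtain ⟨y, hy, rfl⟩ := h.exists_eq hq'
      rw [h.otherCurvature_eq hS hz] at h0
      rw [h.otherCurvature_eq hS hy]
      exact h.patch.umbilic_of_umbilic h.pd_curv (fun z hz => h.weingarten hS hW hz) hd hz h0 hy) hp
    intro q
    obtain ⟨v, w, -, -, -, hv, hw, hvw, -⟩ := exists_principal_frame hS hch q
    refine ⟨k q, fun v' => ?_⟩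
    obtain ⟨α, β, rfl⟩ := hvw v'
    rw [← hall q] at hw
    simp only [map_add, map_smul, hv, hw]
    module
  · right
    push Not at hex
    exact hex

-- The property propagated from chart to chart is vanishing of `K` near a point, not at a point:
-- only the former yields `bend = 0`, which `flat_of_flat_of_bend_eq_zero` also needs.
include hS hch hW in
theorem flat_dichotomy (hd : b ^ 2 - a * c ≠ 0) (hne : ∀ p, k p ≠ otherCurvature x n k p) :
    IsDevelopable x n ∨ ∀ p, ¬ ∀ᶠ q in nhds p, gaussCurvature x n q = 0 := by
  by_cases hex : ∃ p, ∀ᶠ q in nhds p, gaussCurvature x n q = 0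
  · left
    obtain ⟨p, hp⟩ := hex
    have hall := forall_of_locally
      (P := fun p => ∀ᶠ q in nhds p, gaussCurvature x n q = 0) (fun p => by
      obtain ⟨e, u, I, J, h, hp⟩ := hch p
      refine ⟨e.source, e.open_source.mem_nhds hp, fun q hq q' hq' h0 => ?_⟩
      obtain ⟨z, hz, rfl⟩ := h.exists_eq hq
      filter_upwards [e.open_source.mem_nhds hq'] with q'' hq''
      obtain ⟨y, hy, rfl⟩ := h.exists_eq hq''
      rw [(h.curvatures hS hy).1]
      refine h.patch.flat_of_eventually_flat h.pd_curv (fun z hz => h.weingarten hS hW hz) hd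
        (fun z hz => ?_) hz ?_ hy
      · rw [← h.otherCurvature_eq hS hz]; exact hne _
      · filter_upwards [h.eventually_symm hz h0, h.patch.isOpen.mem_nhds hz] with y h1 hy
        rwa [(h.curvatures hS hy).1] at h1) hp
    exact fun q => (hall q).self_of_nhds
  · right
    exact not_exists.1 hex

include hS hch hW in
theorem exists_axis (hd : b ^ 2 - a * c ≠ 0) (hne : ∀ p, k p ≠ otherCurvature x n k p)
    (hnf : ∀ p, ¬ ∀ᶠ q in nhds p, gaussCurvature x n q = 0) :
    ∃ o τ : E3, ‖τ‖ = 1 ∧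
      ∀ p, ∀ v ∈ D p, ⟪τ, diff x p v⟫ = 0 ∧ ⟪x p - o, diff x p v⟫ = 0 := by
  obtain ⟨p₀⟩ : Nonempty M := inferInstance
  have hdata : ∀ (e : OpenPartialHomeomorph M (ℝ × ℝ)) (u : M → ℝ) (I J : Set ℝ),
      IsChannelChart x n D k e u I J →
      (∀ z ∈ I ×ˢ J, pd et (crossCurv (x ∘ e.symm) (n ∘ e.symm)) z = 0) ∧
      (∀ z ∈ I ×ˢ J, (k ∘ e.symm) z ≠ crossCurv (x ∘ e.symm) (n ∘ e.symm) z) ∧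
      ∀ z ∈ I ×ˢ J, (k ∘ e.symm) z ≠ 0 ∨ bend (x ∘ e.symm) z ≠ 0 := by
    intro e u I J h
    have hWp := fun z hz => h.weingarten hS hW (z := z) hz
    have hnep : ∀ z ∈ I ×ˢ J, (k ∘ e.symm) z ≠ crossCurv (x ∘ e.symm) (n ∘ e.symm) z := by
      intro z hz
      rw [← h.otherCurvature_eq hS hz]; exact hne _
    refine ⟨fun z hz => h.patch.pd_crossCurv h.pd_curv hWp hd hz, hnep, fun z hz => ?_⟩
    -- A common zero of `k` and `bend` would make the whole chart flat, contrary to `hnf`.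
    by_contra hcon
    push Not at hcon
    apply hnf (e.symm z)
    filter_upwards [e.open_source.mem_nhds (h.symm_mem hz)] with q hq
    obtain ⟨y, hy, rfl⟩ := h.exists_eq hq
    rw [(h.curvatures hS hy).1]
    exact h.patch.flat_of_flat_of_bend_eq_zero h.pd_curv hWp hd hnep hz (by rw [hcon.1, zero_mul])
      hcon.2 hy
  have hleaf : ∀ (e : OpenPartialHomeomorph M (ℝ × ℝ)) (u : M → ℝ) (I J : Set ℝ),
      IsChannelChart x n D k e u I J → ∀ o τ : E3, ∀ z ∈ I ×ˢ J,
      ((∀ v ∈ D (e.symm z), ⟪τ, diff x (e.symm z) v⟫ = 0 ∧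
        ⟪x (e.symm z) - o, diff x (e.symm z) v⟫ = 0) ↔
      (⟪τ, pd et (x ∘ e.symm) z⟫ = 0 ∧ ⟪(x ∘ e.symm) z - o, pd et (x ∘ e.symm) z⟫ = 0)) := by
    intro e u I J h o τ z hz
    have hq := h.symm_mem hz
    rw [← h.diff_push (hS.mdiffAt_map _) hz]
    constructor
    · intro h0
      exact h0 _ ((h.mem_iff _ hq _).2 (h.fdiff_fst hz et))
    · intro h0 v hv
      obtain ⟨w, rfl⟩ := (h.push_bijective hz).2 v
      rw [h.mem_iff _ hq, h.fdiff_fst hz] at hv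
      have hw : w = w.2 • et := by ext <;> simp [hv]
      rw [hw, map_smul, map_smul, real_inner_smul_right, real_inner_smul_right, h0.1]
      refine ⟨mul_zero _, ?_⟩
      rw [show x (e.symm z) = (x ∘ e.symm) z from rfl, h0.2, mul_zero]
  obtain ⟨e, u, I, J, h, hp⟩ := hch p₀
  obtain ⟨z, hz, rfl⟩ := h.exists_eq hp
  obtain ⟨hl, hnep, hkb⟩ := hdata e u I J h
  set A := IsPatch.axisDir (x ∘ e.symm) (n ∘ e.symm) (k ∘ e.symm) z
  set C := IsPatch.axisPoint (x ∘ e.symm) (n ∘ e.symm) (k ∘ e.symm) z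
  have hA : A ≠ 0 := h.patch.axisDir_ne hkb hz
  refine ⟨C, ‖A‖⁻¹ • A, norm_smul_inv_norm hA, ?_⟩
  -- The axis found in one chart is carried to all others. The condition is imposed near each point,
  -- as `isAxis_of_eventually` requires.
  have key := forall_of_locally (P := fun p => ∀ᶠ q in nhds p, ∀ v ∈ D q,
    ⟪‖A‖⁻¹ • A, diff x q v⟫ = 0 ∧ ⟪x q - C, diff x q v⟫ = 0) (p := e.symm z) (fun p => by
      obtain ⟨e, u, I, J, h, hp⟩ := hch p
      obtain ⟨hl, hnep, hkb⟩ := hdata e u I J h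
      refine ⟨e.source, e.open_source.mem_nhds hp, fun q hq q' hq' h0 => ?_⟩
      obtain ⟨z, hz, rfl⟩ := h.exists_eq hq
      filter_upwards [e.open_source.mem_nhds hq'] with q'' hq''
      obtain ⟨y, hy, rfl⟩ := h.exists_eq hq''
      rw [hleaf e u I J h _ _ y hy]
      refine h.patch.isAxis_of_eventually h.pd_curv hl hnep hkb hz ?_ hy
      filter_upwards [h.eventually_symm hz h0, h.patch.isOpen.mem_nhds hz] with y h1 hy
      exact (hleaf e u I J h _ _ y hy).1 h1) (by
    filter_upwards [e.open_source.mem_nhds hp] with q hq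
    obtain ⟨y, hy, rfl⟩ := h.exists_eq hq
    rw [hleaf e u I J h _ _ y hy, real_inner_smul_left,
      h.patch.inner_axisDir_leaf_eq_zero h.pd_curv hl hnep hkb hz hy, mul_zero]
    exact ⟨rfl, h.patch.inner_sub_axisPoint_leaf h.pd_curv hl hnep hkb hz hy⟩)
  exact fun p => (key p).self_of_nhds

omit [ConnectedSpace M]

include hS hch in
theorem isOfRevolution_parallel {o τ : E3} (hτ : ‖τ‖ = 1)
    (hax : ∀ p, ∀ v ∈ D p, ⟪τ, diff x p v⟫ = 0 ∧ ⟪x p - o, diff x p v⟫ = 0) (t : ℝ) :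
    IsOfRevolution (parallel x n t) := by
  obtain ⟨F, hF⟩ : ∃ F : OrthonormalBasis (Fin 3) ℝ E3, F 2 = τ := by
    have ho : Orthonormal ℝ (({2} : Set (Fin 3)).domRestrict fun _ => τ) := by
      rw [orthonormal_iff_ite]
      rintro ⟨i, hi⟩ ⟨j, hj⟩
      obtain rfl : i = 2 := hi
      obtain rfl : j = 2 := hj
      change ⟪τ, τ⟫ = _
      rw [real_inner_self_eq_norm_sq, hτ]; simp
    obtain ⟨F, hF⟩ := ho.exists_orthonormalBasis_extension_of_card_eq (by simp)
    exact ⟨F, hF 2 rfl⟩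
  refine ⟨o, F, fun p => ?_⟩
  obtain ⟨e, u, I, J, h, hp⟩ := hch p
  have hp' := h.mem_box hp
  obtain ⟨W, θ, r, η, hWo, hpW, hWB, hθ, hr, hη, hind, heq⟩ :=
    h.patch.exists_revolution (o := o) F (fun z hz => by
      have h1 := hax (e.symm z) (push e z et)
        ((h.mem_iff _ (h.symm_mem hz) _).2 (h.fdiff_fst hz et))
      rwa [h.diff_push (hS.mdiffAt_map _) hz, ← hF] at h1) t hp'
  have hsub : e.source ∩ e ⁻¹' W ⊆ e.source := Set.inter_subset_left
  have hθs : ContMDiffOn 𝓘(ℝ, E2) 𝓘(ℝ, ℝ) ∞ (θ ∘ e) (e.source ∩ e ⁻¹' W) :=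
    (contMDiffOn_iff_contDiffOn.2 hθ).comp (h.smooth.mono hsub) fun q hq => hq.2
  have hUo := e.isOpen_inter_preimage hWo
  refine ⟨e.source ∩ e ⁻¹' W, u, θ ∘ e, I, r, η, hUo, ⟨hp, hpW⟩, h.contMDiffOn_fst.mono hsub, hθs,
    ?_, h.isOpen_fst, ?_, hr, hη, ?_⟩
  · rintro q ⟨hq, hqW⟩ v hv hv'
    obtain ⟨z, hz, rfl⟩ := h.exists_eq hq
    have hzW : z ∈ W := by rwa [Set.mem_preimage, e.right_inv (h.mem_target hz)] at hqW
    obtain ⟨w, rfl⟩ := (h.push_bijective hz).2 v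
    rw [h.fdiff_fst hz] at hv
    have hd : MDifferentiableAt 𝓘(ℝ, E2) 𝓘(ℝ, ℝ) (θ ∘ e) (e.symm z) :=
      (hθs.contMDiffAt (hUo.mem_nhds ⟨hq, hqW⟩)).mdifferentiableAt (by simp)
    rw [h.fdiff_push hd hz, pd_congr hWo (g := θ) (fun y hy => ?_) hzW] at hv'
    · rw [hind z hzW w hv hv', map_zero]
    · simp [e.right_inv (h.mem_target (hWB hy))]
  · rintro q ⟨hq, -⟩
    rw [← h.fst_eq q hq]
    exact (h.mem_box hq).1
  · rintro q ⟨hq, hqW⟩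
    have := heq (e q) hqW
    rw [Function.comp_apply, Function.comp_apply, e.left_inv hq, h.fst_eq q hq] at this
    exact this

include hS hch in
theorem isNormalField_parallel (t : ℝ) : IsNormalField (parallel x n t) n where
  smooth_map := hS.smooth_parallel t
  smooth_normal := hS.smooth_normal
  unit := hS.unit
  normal p v' := by
    obtain ⟨v, w, -, -, -, hv, hw, hvw, -⟩ := exists_principal_frame hS hch p
    obtain ⟨α, β, rfl⟩ := hvw v'
    rw [hS.diff_parallel]
    simp only [map_add, map_smul, hv, hw, inner_add_left, inner_neg_left, real_inner_smul_left,
      hS.normal]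
    simp

-- Principal directions are kept by parallel surfaces: there `diff n` is `-k` or `-l` times `diff
-- x`, so `diff (parallel x n t)` is `1 - t k` or `1 - t l` times `diff x`.
include hS hch in
theorem isRegularAt_parallel_iff (t : ℝ) (p : M) : IsRegularAt (parallel x n t) p ↔
    1 - t * k p ≠ 0 ∧ 1 - t * otherCurvature x n k p ≠ 0 := by
  obtain ⟨v, w, hv0, hw0, ho, hv, hw, hvw, -⟩ := exists_principal_frame hS hch p
  have hyv : diff (parallel x n t) p v = (1 - t * k p) • diff x p v := by
    rw [hS.diff_parallel, hv]; module
  have hyw : diff (parallel x n t) p w = (1 - t * otherCurvature x n k p) • diff x p w := by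
    rw [hS.diff_parallel, hw]; module
  have hx0 : ∀ v, v ≠ 0 → diff x p v ≠ 0 := fun v hv0 h0 =>
    hv0 (hS.regular p (by rw [h0, map_zero]))
  constructor
  · intro hr
    constructor
    · intro h0
      exact hv0 (hr (by rw [hyv, h0, zero_smul, map_zero]))
    · intro h0
      exact hw0 (hr (by rw [hyw, h0, zero_smul, map_zero]))
  · rintro ⟨h1, h2⟩
    rw [IsRegularAt, injective_iff_map_eq_zero]
    intro v' h0
    obtain ⟨α, β, rfl⟩ := hvw v'
    rw [map_add, map_smul, map_smul, hyv, hyw] at h0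
    have e1 := congrArg (fun y => ⟪y, diff x p v⟫) h0
    have e2 := congrArg (fun y => ⟪y, diff x p w⟫) h0
    have ho' : ⟪diff x p w, diff x p v⟫ = 0 := by rw [real_inner_comm]; exact ho
    simp only [inner_add_left, real_inner_smul_left, inner_zero_left, ho, ho', mul_zero, add_zero,
      zero_add, mul_eq_zero, h1, h2, (real_inner_self_pos.2 (hx0 v hv0)).ne',
      (real_inner_self_pos.2 (hx0 w hw0)).ne', or_false] at e1 e2
    rw [e1, e2]; simp

include hS hch in
theorem curvatures_parallel {t : ℝ} {p : M} (hr : IsRegularAt (parallel x n t) p) :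
    gaussCurvature (parallel x n t) n p = k p / (1 - t * k p) *
        (otherCurvature x n k p / (1 - t * otherCurvature x n k p)) ∧
      meanCurvature (parallel x n t) n p = (k p / (1 - t * k p) +
        otherCurvature x n k p / (1 - t * otherCurvature x n k p)) / 2 := by
  obtain ⟨h1, h2⟩ := (isRegularAt_parallel_iff hS hch t p).1 hr
  obtain ⟨v, w, hv0, hw0, ho, hv, hw, hvw, -⟩ := exists_principal_frame hS hch p
  have hyv : diff (parallel x n t) p v = (1 - t * k p) • diff x p v := by
    rw [hS.diff_parallel, hv]; module
  have hyw : diff (parallel x n t) p w = (1 - t * otherCurvature x n k p) • diff x p w := by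
    rw [hS.diff_parallel, hw]; module
  refine curvatures_of_principal hr hv0 hw0 ?_ ?_ ?_
  · rw [hyv, hyw, real_inner_smul_left, real_inner_smul_right, ho]; simp
  · rw [hyv, smul_smul, div_mul_cancel₀ _ h1]; exact hv
  · rw [hyw, smul_smul, div_mul_cancel₀ _ h2]; exact hw

end Global

end ChannelSurface

/-! ### The classification theorem -/

open ChannelSurface in
theorem mainTheorem3 {M : Type*} [TopologicalSpace M] [ChartedSpace ChannelSurface.E2 M]
    [IsManifold 𝓘(ℝ, ChannelSurface.E2) ∞ M] [T2Space M] [SecondCountableTopology M]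
    [ConnectedSpace M] (x n : M → ChannelSurface.E3)
    (hsurface : ChannelSurface.IsSurface x n)
    (hchannel : ChannelSurface.IsChannel x n)
    (hweingarten : ChannelSurface.IsLinearWeingarten x n) :
    ChannelSurface.IsTubular x n ∨
      ∃ t : ℝ, ChannelSurface.IsOfRevolution (ChannelSurface.parallel x n t) ∧
        (ChannelSurface.IsMinimal (ChannelSurface.parallel x n t) n ∨
          ∃ k : ℝ, k ≠ 0 ∧
            ChannelSurface.HasConstantGaussCurvature (ChannelSurface.parallel x n t) n k) := by
  obtain ⟨D, hk, hD⟩ := hchannel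
  obtain ⟨a, b, c, habc, hW⟩ := hweingarten
  choose k hk using hk
  have hch := exists_isChannelChart hsurface hk hD
  by_cases hd : b ^ 2 - a * c = 0
  · exact Or.inl (isTubular_of_disc_eq_zero hsurface hch hW habc hd)
  rcases umbilic_dichotomy hsurface hch hW hd with hu | hne
  · exact Or.inl (Or.inr (Or.inr hu))
  rcases flat_dichotomy hsurface hch hW hd hne with hf | hnf
  · exact Or.inl (Or.inr (Or.inl hf))
  right
  obtain ⟨o, τ, hτ, hax⟩ := exists_axis hsurface hch hW hd hne hnf
  have hrev := isOfRevolution_parallel hsurface hch hτ hax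
  have hnorm := isNormalField_parallel hsurface hch
  have hreg := isRegularAt_parallel_iff hsurface hch
  have hK : ∀ p, gaussCurvature x n p = k p * otherCurvature x n k p := fun p => by
    obtain ⟨_, _, _, _, _, _, _, _, hK⟩ := exists_principal_frame hsurface hch p
    exact hK
  have hkl : ∀ p, a * (k p * otherCurvature x n k p) + b * (k p + otherCurvature x n k p) + c = 0 :=
    fun p => by
    have := hW p
    rw [hK] at this
    rw [← this, otherCurvature]; ring
  by_cases hc : c = 0
  · subst hc
    have hb : b ≠ 0 := by rintro rfl; simp at hd
    -- The numerator of the new mean curvature is `k + l - 2 t k l`, which for this `t` is `(a k l +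
    -- b (k + l)) / b = 0`. A singular point, say `2 b + a k = 0`, would give `b (k - l) = 0`, an
    -- umbilic.
    refine ⟨-a / (2 * b), hrev _, Or.inl ?_⟩
    have hr : ∀ p, IsRegularAt (parallel x n (-a / (2 * b))) p := by
      intro p
      rw [hreg]
      have h1 := hkl p
      have h2 := hne p
      set l := otherCurvature x n k p
      constructor
      · intro h0
        field_simp at h0
        apply h2
        apply mul_left_cancel₀ hb
        linear_combination h1 - l * h0
      · intro h0
        field_simp at h0
        apply h2
        apply mul_left_cancel₀ hb
        linear_combination k p * h0 - h1
    refine ⟨⟨hnorm _, hr⟩, fun p => ?_⟩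
    obtain ⟨h1, h2⟩ := (hreg _ p).1 (hr p)
    rw [(curvatures_parallel hsurface hch (hr p)).2, div_add_div _ _ h1 h2]
    have h3 := hkl p
    set l := otherCurvature x n k p
    rw [div_eq_zero_iff, div_eq_zero_iff]
    left; left
    field_simp
    linear_combination 2 * h3
  -- By the relation, `(c + b k)(c + b l) = (b² - a c) K`. Thus the parallel surface is singular
  -- exactly where `K = 0`, and elsewhere `K` cancels from its Gauss curvature.
  · refine ⟨-b / c, hrev _, Or.inr ⟨c ^ 2 / (b ^ 2 - a * c), div_ne_zero (pow_ne_zero 2 hc) hd,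
      hnorm _, ?_, ?_⟩⟩
    · rw [dense_iff_inter_open]
      rintro U hU ⟨p, hp⟩
      -- An open set without regular points would be an open set on which `K = 0`, which `hnf`
      -- excludes.
      by_contra hcon
      apply hnf p
      filter_upwards [hU.mem_nhds hp] with q hq
      by_contra hKq
      apply hcon
      refine ⟨q, hq, (hreg _ q).2 ?_⟩
      have h1 := hkl q
      rw [hK] at hKq
      set l := otherCurvature x n k q
      have hk0 := left_ne_zero_of_mul hKq
      have hl0 := right_ne_zero_of_mul hKq
      constructor
      · intro h0
        field_simp at h0
        have h2 : l * (a * k q + b) = 0 := by linear_combination h1 - h0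
        apply hd
        linear_combination (a * l + b) * (mul_eq_zero.1 h2).resolve_left hl0 - a * h1
      · intro h0
        field_simp at h0
        have h2 : k q * (a * l + b) = 0 := by linear_combination h1 - h0
        apply hd
        linear_combination (a * k q + b) * (mul_eq_zero.1 h2).resolve_left hk0 - a * h1
    · intro p hr
      obtain ⟨h1, h2⟩ := (hreg _ p).1 hr
      rw [(curvatures_parallel hsurface hch hr).1]
      have h3 := hkl p
      set l := otherCurvature x n k p
      have e1 : 1 - -b / c * k p = (c + b * k p) / c := by field_simp; ring
      have e2 : 1 - -b / c * l = (c + b * l) / c := by field_simp; ring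
      rw [e1] at h1 ⊢
      rw [e2] at h2 ⊢
      have n1 : c + b * k p ≠ 0 := fun h0 => h1 (by rw [h0, zero_div])
      have n2 : c + b * l ≠ 0 := fun h0 => h2 (by rw [h0, zero_div])
      rw [div_div_eq_mul_div, div_div_eq_mul_div, div_mul_div_comm,
        div_eq_div_iff (mul_ne_zero n1 n2) hd]
      linear_combination (-c ^ 3) * h3
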